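/- **Setting ($q=0$).** Let $\mathcal H$ be the Hilbert space with orthonormal basis $e^{(n)}_{ij}$, where $n\in\frac12\mathbb N$ and $i,j\in\{-n,-n+1,\dots,n\}$. Let $\alpha,\beta$ be the bounded operators on $\mathcal H$ with $\alpha e^{(n)}_{ij}=e^{(n-1/2)}_{i-1/2,\,j-1/2}$ if $i>-n$ and $j>-n$, and $\alpha e^{(n)}_{ij}=0$ otherwise; $\beta e^{(n)}_{i,-n}=-e^{(n+1/2)}_{i+1/2,\,-(n+1/2)}$, $\beta e^{(n)}_{-n,j}=e^{(n-1/2)}_{-(n-1/2),\,j-1/2}$ if $j\neq -n$, and $\beta e^{(n)}_{ij}=0$ if $i\ne -n$ and $j\neq -n$. For $f\in C^\infty(S^1)$ with Fourier coefficients $\hat f_m$ put $f(\beta)=\sum_{m>0}\hat f_m\beta^m+\sum_{m<0}\hat f_m(\beta^*)^{-m}+\hat f_0\,\beta^*\beta$. Let $\mathcal A$ be the set of all sums $$a=\sum_{k,\ell\ge0}\alpha^{*k}f_{k\ell}(\beta)\alpha^\ell+\sum_{\ell\ge0}\lambda_\ell\alpha^\ell+\sum_{k>0}\lambda'_k\alpha^{*k}$$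 with $\lambda,\lambda'$ complex sequences of rapid decay and $(f_{k\ell})$ a double sequence of rapid decay with values in $C^\infty(S^1)$. Let $D$ be the unbounded self-adjoint diagonal operator with $De^{(n)}_{ij}=2n\,e^{(n)}_{ij}$ if $i=n$ and $De^{(n)}_{ij}=-2n\,e^{(n)}_{ij}$ if $i\ne n$; let $\delta(T)=[|D|,T]$, as an unbounded derivation of the bounded operators on $\mathcal H$. Let $\mathcal B$ be the algebra generated by all $\delta^k(a)$ and $\delta^k([D,a])$, $a\in\mathcal A$, $k\ge0$. Fix $\varepsilon>0$, and in $|D|^{-s}$ replace the eigenvalue $0$ of $|D|$ by $\varepsilon$. For $b\in\mathcal B$ and $\operatorname{Re}s>3$ let $\zeta_b(s)=\operatorname{Trace}(b|D|^{-s})$. **Theorem 2.** For every $a\in\mathcal A$ the commutator $[D,a]$ is bounded, and $a$ and $[D,a]$ are in the domain of $\delta^k$ for all $k$. For every $b\in\mathcal B$ and $\operatorname{Re}s>3$ the operator $b|D|^{-s}$ is of trace class. The dimension spectrum of $(\mathcal A,\mathcal H,D)$ is simple and equal to $\{1,2,3\}$: every $\zeta_b$, $b\in\mathcal B$, extends to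 a meromorphic function on $\mathbb C$ that is holomorphic off $\{1,2,3\}$ and has at most simple poles at $1,2,3$, and for each of these three points there is a $b\in\mathcal B$ for which $\zeta_b$ is singular there. In fact, for every $b\in\mathcal B$ there are scalars $\lambda_1,\lambda_2,\lambda_3\in\mathbb C$, independent of $\varepsilon$, and an entire function $\rho$ with $$\zeta_b(s)=\lambda_3\,\zeta(s-2)+\lambda_2\,\zeta(s-1)+\lambda_1\,\zeta(s)+\rho(s)\qquad(\operatorname{Re}s>3),$$ where $\zeta$ is the Riemann zeta function. -/

import Mathlib

open scoped ContDiff InnerProductSpace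

noncomputable section

namespace QuantumSU2

/-! ### The Hilbert space -/

/-- Labels of the orthonormal basis `e^{(n)}_{ij}`, with `n ∈ {0, 1/2, 1, …}` and
`i, j ∈ {-n, -n+1, …, n}`.  The half-integers are encoded by the natural numbers
`N = 2n`, `x = i + n`, `y = j + n`, so that `0 ≤ x, y ≤ N`.  Thus `i = -n` reads `x = 0`,
`i = n` reads `x = N`, and `j = -n` reads `y = 0`. -/
@[ext] structure Idx where
  N : ℕ
  x : ℕ
  y : ℕ
  hx : x ≤ N
  hy : y ≤ N

/-- The Hilbert space with orthonormal basis `e^{(n)}_{ij}`. -/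
abbrev H : Type := lp (fun _ : Idx => ℂ) 2

theorem H_ext {ξ η : H} (h : ∀ i, ξ i = η i) : ξ = η := lp.ext (funext h)

open Classical in
/-- The basis vector with label `i`. -/
def e (i : Idx) : H := lp.single 2 i (1 : ℂ)

open Classical in
theorem e_apply (i j : Idx) : e i j = if j = i then 1 else 0 := by
  simp [e, Pi.single_apply]

/-! ### Bounded operators given by coordinates -/

theorem weightedPull_sum_le (c : Idx → ℂ) (φ : Idx → Idx) (C : ℝ) (hc : ∀ i, ‖c i‖ ≤ C)
    (hφ : Set.InjOn φ (Function.support c)) (ξ : H) (s : Finset Idx) :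
    ∑ i ∈ s, ‖c i * ξ (φ i)‖ ^ (2 : ENNReal).toReal ≤ (C * ‖ξ‖) ^ (2 : ENNReal).toReal := by
  classical
  have h2 : (2 : ENNReal).toReal = ((2 : ℕ) : ℝ) := by simp
  have key := lp.sum_rpow_le_norm_rpow (p := 2) (by norm_num) ξ ((s.filter (c · ≠ 0)).image φ)
  simp only [h2, Real.rpow_natCast] at key ⊢
  rw [Finset.sum_image] at key
  · calc ∑ i ∈ s, ‖c i * ξ (φ i)‖ ^ 2
        = ∑ i ∈ s.filter (c · ≠ 0), ‖c i * ξ (φ i)‖ ^ 2 := by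
          symm
          apply Finset.sum_subset (Finset.filter_subset _ _)
          intro i hi hi'
          have : c i = 0 := by simpa [hi] using hi'
          simp [this]
      _ ≤ ∑ i ∈ s.filter (c · ≠ 0), C ^ 2 * ‖ξ (φ i)‖ ^ 2 := by
          apply Finset.sum_le_sum
          intro i _
          rw [norm_mul, mul_pow]
          have := hc i
          gcongr
      _ ≤ (C * ‖ξ‖) ^ 2 := by
          rw [← Finset.mul_sum, mul_pow]
          gcongr
  · intro i hi j hj hij
    exact hφ (by simpa using (Finset.mem_filter.mp hi).2)
      (by simpa using (Finset.mem_filter.mp hj).2) hij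

/-- The bounded operator `ξ ↦ (i ↦ c i * ξ (φ i))`, for bounded weights `c` and a map `φ` that is
injective where `c` does not vanish. -/
def weightedPull (c : Idx → ℂ) (φ : Idx → Idx) (C : ℝ) (hc : ∀ i, ‖c i‖ ≤ C)
    (hφ : Set.InjOn φ (Function.support c)) : H →L[ℂ] H :=
  LinearMap.mkContinuous
    { toFun := fun ξ =>
        ⟨fun i => c i * ξ (φ i), memℓp_gen' (weightedPull_sum_le c φ C hc hφ ξ)⟩
      map_add' := fun ξ η => by ext i; exact mul_add _ _ _
      map_smul' := fun z ξ => by ext i; simp [mul_left_comm] }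
    |C|
    (fun ξ => by
      refine lp.norm_le_of_forall_sum_le (by norm_num) (by positivity) fun s => ?_
      exact weightedPull_sum_le c φ |C| (fun i => (hc i).trans (le_abs_self C)) hφ ξ s)

theorem weightedPull_apply (c : Idx → ℂ) (φ : Idx → Idx) (C : ℝ) (hc : ∀ i, ‖c i‖ ≤ C)
    (hφ : Set.InjOn φ (Function.support c)) (ξ : H) (i : Idx) :
    weightedPull c φ C hc hφ ξ i = c i * ξ (φ i) := rfl

open Classical in
/-- The diagonal operator with eigenvalues `w`, when `w` is bounded (and `0` otherwise). -/
def boundedDiag (w : Idx → ℂ) : H →L[ℂ] H :=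
  if h : ∃ C : ℝ, ∀ i, ‖w i‖ ≤ C then
    weightedPull w id h.choose h.choose_spec (Function.injective_id.injOn)
  else 0

theorem boundedDiag_apply {w : Idx → ℂ} (h : ∃ C : ℝ, ∀ i, ‖w i‖ ≤ C) (ξ : H) (i : Idx) :
    boundedDiag w ξ i = w i * ξ i := by
  rw [boundedDiag, dif_pos h]; rfl

/-! ### The generators `α`, `β` at `q = 0` -/

/-- The operator `α`, written in coordinates; `alpha_e` gives its action on the basis. -/
def alpha : H →L[ℂ] H :=
  weightedPull (fun _ => 1)
    (fun t => ⟨t.N + 1, t.x + 1, t.y + 1, Nat.succ_le_succ t.hx, Nat.succ_le_succ t.hy⟩) 1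
    (fun _ => by simp)
    (by
      rintro ⟨N, x, y, _, _⟩ _ ⟨N', x', y', _, _⟩ _ h
      simpa using h)

/-- The coordinates of `β ξ` are those of `ξ` at shifted labels, up to sign; `beta_e` gives the
action of `β` on the basis. -/
def beta : H →L[ℂ] H :=
  weightedPull
    (fun t => if t.x = 0 then 1 else if t.y = 0 then -1 else 0)
    (fun t => if t.x = 0 then ⟨t.N + 1, 0, t.y + 1, Nat.zero_le _, Nat.succ_le_succ t.hy⟩
      else ⟨t.N - 1, t.x - 1, 0, Nat.sub_le_sub_right t.hx 1, Nat.zero_le _⟩) 1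
    (fun t => by split_ifs <;> simp)
    (by
      rintro ⟨N, x, y, _, _⟩ h1 ⟨N', x', y', _, _⟩ h2 h
      simp only [Function.mem_support] at h1 h2
      split_ifs at h h1 h2 <;> simp_all
      omega)

theorem alpha_apply (ξ : H) (t : Idx) :
    alpha ξ t =
      ξ ⟨t.N + 1, t.x + 1, t.y + 1, Nat.succ_le_succ t.hx, Nat.succ_le_succ t.hy⟩ :=
  (weightedPull_apply _ _ _ _ _ _ _).trans (one_mul _)

/-- `α e^{(n)}_{ij} = e^{(n-1/2)}_{i-1/2, j-1/2}` if `i > -n` and `j > -n`, and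
`α e^{(n)}_{ij} = 0` otherwise. -/
theorem alpha_e (t : Idx) :
    alpha (e t) = if 0 < t.x ∧ 0 < t.y then
      e ⟨t.N - 1, t.x - 1, t.y - 1, Nat.sub_le_sub_right t.hx 1, Nat.sub_le_sub_right t.hy 1⟩
    else 0 := by
  obtain ⟨N, x, y, hx, hy⟩ := t
  refine H_ext fun ⟨M, u, v, hu, hv⟩ => ?_
  refine (alpha_apply _ _).trans ?_
  rw [e_apply]
  split_ifs with h1 h2 h2
  · rw [e_apply, if_pos]
    simp only [Idx.mk.injEq] at h1 ⊢
    omega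
  · simp only [Idx.mk.injEq] at h1 h2
    omega
  · rw [e_apply, if_neg]
    simp only [Idx.mk.injEq] at h1 h2 ⊢
    omega
  · rfl

theorem beta_apply (ξ : H) (t : Idx) :
    beta ξ t = if t.x = 0 then ξ ⟨t.N + 1, 0, t.y + 1, Nat.zero_le _, Nat.succ_le_succ t.hy⟩
      else if t.y = 0 then -ξ ⟨t.N - 1, t.x - 1, 0, Nat.sub_le_sub_right t.hx 1, Nat.zero_le _⟩
      else 0 := by
  refine (weightedPull_apply _ _ _ _ _ _ _).trans ?_
  by_cases h : t.x = 0
  · simp only [h, if_true, one_mul]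
  · by_cases h' : t.y = 0
    · simp only [h, h', if_true, if_false, neg_mul, one_mul]
    · simp only [h, h', if_false, zero_mul]

/-- `β e^{(n)}_{i,-n} = - e^{(n+1/2)}_{i+1/2, -(n+1/2)}`;
`β e^{(n)}_{-n,j} = e^{(n-1/2)}_{-(n-1/2), j-1/2}` if `j ≠ -n`; and `β e^{(n)}_{ij} = 0` if
`i ≠ -n` and `j ≠ -n`. -/
theorem beta_e (t : Idx) :
    beta (e t) = if t.y = 0 then
      -e ⟨t.N + 1, t.x + 1, 0, Nat.succ_le_succ t.hx, Nat.zero_le _⟩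
    else if t.x = 0 then
      e ⟨t.N - 1, 0, t.y - 1, Nat.zero_le _, Nat.sub_le_sub_right t.hy 1⟩
    else 0 := by
  obtain ⟨N, x, y, hx, hy⟩ := t
  refine H_ext fun ⟨M, u, v, hu, hv⟩ => (beta_apply _ _).trans ?_
  by_cases hy0 : y = 0
  · rw [if_pos hy0, lp.coeFn_neg, Pi.neg_apply]
    simp only [e_apply, Idx.mk.injEq]
    split_ifs <;> first | omega | simp
  · rw [if_neg hy0]
    by_cases hx0 : x = 0
    · rw [if_pos hx0]
      simp only [e_apply, Idx.mk.injEq]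
      split_ifs <;> first | omega | simp
    · rw [if_neg hx0]
      simp only [e_apply, Idx.mk.injEq]
      split_ifs <;> first | omega | rfl | exact neg_zero

/-! ### The smooth algebra `𝒜` -/

/-- `β^m` for `m > 0`, `(β*)^{-m}` for `m < 0`, and for `m = 0` the projection
`β* β = β β*` onto the span of the basis vectors with `i = -n` or `j = -n`. -/
def betaPow (m : ℤ) : H →L[ℂ] H :=
  if m = 0 then star beta * beta
  else if 0 < m then beta ^ m.toNat
  else star beta ^ (-m).toNat

/-- `f(β) = ∑ₘ f̂(m) βᵐ` for a `2π`-periodic function `f` of the real variable `θ`, where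
`f(θ) = ∑ₘ f̂(m) e^{imθ}`. -/
def funBeta (f : ℝ → ℂ) : H →L[ℂ] H :=
  ∑' m : ℤ, fourierCoeffOn Real.two_pi_pos f m • betaPow m

/-- Smooth functions on the circle, as `2π`-periodic smooth functions on the line. -/
def IsSmoothCircle (f : ℝ → ℂ) : Prop :=
  Function.Periodic f (2 * Real.pi) ∧ ContDiff ℝ ∞ f

/-- A sequence of complex numbers of rapid decay. -/
def RapidDecay (l : ℕ → ℂ) : Prop :=
  ∀ r : ℕ, ∃ C : ℝ, ∀ k : ℕ, (1 + (k : ℝ)) ^ r * ‖l k‖ ≤ C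

/-- A double sequence of smooth functions on the circle, of rapid decay in the Fréchet space
`C^∞(S¹)` with its seminorms `f ↦ sup |f^{(j)}|`. -/
def RapidDecaySmooth (f : ℕ → ℕ → ℝ → ℂ) : Prop :=
  (∀ k l, IsSmoothCircle (f k l)) ∧
    ∀ r j : ℕ, ∃ C : ℝ, ∀ (k l : ℕ) (θ : ℝ),
      (1 + (k : ℝ) + (l : ℝ)) ^ r * ‖iteratedDeriv j (f k l) θ‖ ≤ C

/-- The algebra `𝒜` of all sums
`∑_{k,l ≥ 0} α*ᵏ f_{kl}(β) αˡ + ∑_{l ≥ 0} λ_l αˡ + ∑_{k > 0} λ'_k α*ᵏ`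
with coefficients of rapid decay (these series converge absolutely in norm). -/
def smoothAlg : Set (H →L[ℂ] H) :=
  {a | ∃ (f : ℕ → ℕ → ℝ → ℂ) (lam lam' : ℕ → ℂ),
    RapidDecaySmooth f ∧ RapidDecay lam ∧ RapidDecay lam' ∧
    a = (∑' p : ℕ × ℕ, star alpha ^ p.1 * funBeta (f p.1 p.2) * alpha ^ p.2)
      + (∑' l : ℕ, lam l • alpha ^ l)
      + (∑' k : ℕ, lam' k • star alpha ^ (k + 1))}

/-! ### The Dirac operator and the derivation `δ` -/

/-- The (in general unbounded) diagonal operator with eigenvalues `w`, on its maximal domain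
`{ξ : ∑ |w_i ξ_i|² < ∞}`. -/
def diagOp (w : Idx → ℂ) : H →ₗ.[ℂ] H where
  domain :=
    { carrier := {ξ : H | Memℓp (fun i => w i * ξ i) 2}
      add_mem' := fun {ξ η} hξ hη => by
        have h := Memℓp.add hξ hη
        have e1 : ((fun i => w i * ξ i) + fun i => w i * η i) = fun i => w i * (ξ + η) i := by
          funext i; simp [mul_add]
        rw [e1] at h
        exact h
      zero_mem' := by
        have h : Memℓp (0 : Idx → ℂ) 2 := zero_memℓp
        have e1 : (fun i => w i * (0 : H) i) = (0 : Idx → ℂ) := by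
          funext i; simp
        show Memℓp (fun i => w i * (0 : H) i) 2
        rw [e1]; exact h
      smul_mem' := fun z ξ hξ => by
        have h := Memℓp.const_smul hξ z
        have e1 : (z • fun i => w i * ξ i) = fun i => w i * (z • ξ) i := by
          funext i; simp [mul_left_comm]
        rw [e1] at h
        exact h }
  toFun :=
    { toFun := fun ξ => ⟨fun i => w i * (ξ : H) i, ξ.2⟩
      map_add' := fun ξ η => by ext i; exact mul_add _ _ _
      map_smul' := fun z ξ => by ext i; simp [mul_left_comm] }

/-- The eigenvalue `(2 δ₀(n - i) - 1) 2n` of `D` at `e^{(n)}_{ij}`. -/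
def diracEig (t : Idx) : ℝ := if t.x = t.N then (t.N : ℝ) else -(t.N : ℝ)

/-- The diagonal operator `D`. -/
def dirac : H →ₗ.[ℂ] H := diagOp fun t => ((diracEig t : ℝ) : ℂ)

/-- The operator `|D|`, which has eigenvalue `2n` at `e^{(n)}_{ij}`. -/
def absDirac : H →ₗ.[ℂ] H := diagOp fun t => ((|diracEig t| : ℝ) : ℂ)

/-- The bounded operator `T` preserves the domain of `A`, and the commutator `[A, T]`, defined on
that domain, is the restriction of the bounded operator `S`. -/
def IsCommutator (A : H →ₗ.[ℂ] H) (T S : H →L[ℂ] H) : Prop :=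
  ∀ ξ : A.domain, ∃ h : T (ξ : H) ∈ A.domain, A ⟨T (ξ : H), h⟩ - T (A ξ) = S (ξ : H)

/-- `T` is in the domain of `δᵏ`, and `δᵏ(T) = S`, where `δ(T) = [|D|, T]`. -/
def IsDelta : ℕ → (H →L[ℂ] H) → (H →L[ℂ] H) → Prop
  | 0, T, S => S = T
  | k + 1, T, S => ∃ R, IsDelta k T R ∧ IsCommutator absDirac R S

/-- The algebra `ℬ` generated by the `δᵏ(a)` and `δᵏ([D, a])`, for `a ∈ 𝒜` and `k ≥ 0`. -/
def algB : Subalgebra ℂ (H →L[ℂ] H) :=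
  Algebra.adjoin ℂ {T | ∃ a ∈ smoothAlg, ∃ k : ℕ,
    IsDelta k a T ∨ ∃ da, IsCommutator dirac a da ∧ IsDelta k da T}

/-! ### Traces and zeta functions -/

/-- The absolute value `|T| = (T* T)^{1/2}` of a bounded operator on a Hilbert space. -/
def absOp {E : Type*} [NormedAddCommGroup E] [InnerProductSpace ℂ E] [CompleteSpace E]
    (T : E →L[ℂ] E) : E →L[ℂ] E := CFC.abs T

/-- `T` is of trace class: the positive operator `|T| = (T* T)^{1/2}` has finite trace. -/
def IsTraceClass (T : H →L[ℂ] H) : Prop :=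
  Summable fun i : Idx => ⟪e i, absOp T (e i)⟫_ℂ

/-- The trace of a trace class operator. -/
def opTrace (T : H →L[ℂ] H) : ℂ := ∑' i : Idx, ⟪e i, T (e i)⟫_ℂ

/-- The eigenvalues of `|D|`, the eigenvalue `0` being replaced by `ε`. -/
def absDiracEig (ε : ℝ) (t : Idx) : ℝ := if |diracEig t| = 0 then ε else |diracEig t|

/-- The operator `|D|^{-s}`, with `|D|` replaced by `ε > 0` on the kernel of `D`; it is bounded
for `Re s ≥ 0`, and only used there. -/
def absDiracNegPow (ε : ℝ) (s : ℂ) : H →L[ℂ] H :=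
  boundedDiag fun t => ((absDiracEig ε t : ℝ) : ℂ) ^ (-s)

theorem absDiracNegPow_apply {ε : ℝ} (hε : 0 < ε) {s : ℂ} (hs : 0 ≤ s.re) (ξ : H) (t : Idx) :
    absDiracNegPow ε s ξ t = ((absDiracEig ε t : ℝ) : ℂ) ^ (-s) * ξ t := by
  refine boundedDiag_apply ⟨max 1 (ε ^ (-s.re)), fun i => ?_⟩ ξ t
  have habs : |diracEig i| = i.N := by
    unfold diracEig; split_ifs <;> simp
  unfold absDiracEig
  rw [habs]
  split_ifs with h
  · rw [Complex.norm_cpow_eq_rpow_re_of_pos hε]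
    exact le_max_right _ _
  · have h0 : i.N ≠ 0 := by exact_mod_cast h
    have h1 : (1 : ℝ) ≤ i.N := by exact_mod_cast Nat.one_le_iff_ne_zero.mpr h0
    rw [Complex.norm_cpow_eq_rpow_re_of_pos (by linarith)]
    refine le_trans ?_ (le_max_left _ _)
    exact Real.rpow_le_one_of_one_le_of_nonpos h1 (by simpa using hs)

/-- `ζ_b(s) = Trace (b |D|^{-s})`, for `Re s > 3`. -/
def zetaFun (ε : ℝ) (b : H →L[ℂ] H) (s : ℂ) : ℂ := opTrace (b * absDiracNegPow ε s)

/-- Given a family `𝓕` of functions on the half plane `Re s > p`, the closed discrete set `S` is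
the set of their singularities, and all of these are simple poles: each member of `𝓕` extends to
a holomorphic function on `ℂ \ S` with at most simple poles at the points of `S`, and at each
point of `S` some member of `𝓕` is actually singular. -/
structure IsSimpleDimensionSpectrum (p : ℝ) (𝓕 : Set (ℂ → ℂ)) (S : Set ℂ) : Prop where
  isClosed : IsClosed S
  isDiscrete : IsDiscrete S
  extension : ∀ ζ ∈ 𝓕, ∃ Z : ℂ → ℂ, Meromorphic Z ∧ AnalyticOnNhd ℂ Z Sᶜ ∧
    (∀ z ∈ S, -1 ≤ meromorphicOrderAt Z z) ∧ ∀ s : ℂ, p < s.re → s ∉ S → Z s = ζ s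
  singular : ∀ z ∈ S, ∃ ζ ∈ 𝓕, ¬ ∃ Z : ℂ → ℂ, AnalyticOnNhd ℂ Z (insert z Sᶜ) ∧
    ∀ s : ℂ, p < s.re → s ∉ S → Z s = ζ s

end QuantumSU2

end

open QuantumSU2

/-! In the coordinates (k, m, c) = (min x y, x - y, N - max x y) the basis is indexed by the points
of ℤ³ with k, c ≥ 0. There α lowers k by one, and β, up to a sign which a diagonal unitary removes,
raises m by one on the face k = 0 and vanishes off it. The operator |D| is multiplication by the
length k + |m| + c, and D = |D| (2χ - 1), where χ is the indicator function of c = 0, m ≥ 0.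

Operators thus become kernels on ℤ³ × ℤ³, extended by zero. The proof rests on one class of kernels,
`SmoothKernel`: they decay rapidly off the diagonal, and in each of the three directions their
increment under diagonal translation decays rapidly in the corresponding coordinate as well. A
Leibniz rule makes this class an algebra (`SmoothKernel.conv`). It is stable under δ, which
multiplies a kernel by a difference of lengths and so costs one power of the distance to the
diagonal (`SmoothKernel.mul_ptLength`). It contains 𝒜: the series in α and α* are translation
invariant away from the walls, and the part built from the f_{kl}(β) decays in k and is translation
invariant in m and c away from m = 0 and c = 0. It contains [D, a]: the dangerous term is a jump of
χ times a length; it sees only the f_{kl} part, and there it forces c = 0 and bounds |m| by the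
distance to the diagonal, while the decay in k does the rest (`smoothKernel_jump`). Hence every
element of ℬ has a smooth kernel.

On each of the two halves m ≥ 0 and m < 0, the diagonal of a smooth kernel is a function on ℕ³ whose
difference in each variable decays rapidly in that variable. Differencing its sum over a + b + c = n
once in each variable leaves boundary terms of the same kind in lower dimension and the sum of the
mixed third difference, which decays in all variables. So the third difference of the level sums is
rapid (`asympPoly_simplexSum`), and the level sums are a quadratic polynomial plus a rapid error
(`AsympPoly.exists_quadratic`). The monomials n², n, 1 give ζ(s-2), ζ(s-1), ζ(s); the error gives an
entire Dirichlet series; ε enters only through the level n = 0. For b = 1 the polynomial is (n +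
1)², so all three residues are nonzero. -/

noncomputable section

namespace QuantumSU2

/-! ### Families of rapid decay -/

/-- `f` decays faster than every power of the weight `w`. -/
def Rapid {X : Type*} (w : X → ℕ) (f : X → ℂ) : Prop :=
  ∀ r : ℕ, ∃ C : ℝ, ∀ x, (1 + (w x : ℝ)) ^ r * ‖f x‖ ≤ C

namespace Rapid

variable {X Y : Type*} {w w' : X → ℕ} {f g : X → ℂ}

theorem exists_bound (hf : Rapid w f) (r : ℕ) :
    ∃ C : ℝ, 0 ≤ C ∧ ∀ x, ‖f x‖ ≤ C * ((1 + (w x : ℝ)) ^ r)⁻¹ := by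
  obtain ⟨C, hC⟩ := hf r
  refine ⟨|C|, abs_nonneg _, fun x => ?_⟩
  have h0 : 0 < (1 + (w x : ℝ)) ^ r := by positivity
  rw [← div_eq_mul_inv, le_div_iff₀ h0, mul_comm]
  exact (hC x).trans (le_abs_self C)

theorem exists_le (hf : Rapid w f) : ∃ C : ℝ, ∀ x, ‖f x‖ ≤ C := by
  obtain ⟨C, hC⟩ := hf 0
  exact ⟨C, fun x => by simpa using hC x⟩

theorem zero (w : X → ℕ) : Rapid w (0 : X → ℂ) := fun r => ⟨0, fun x => by simp⟩

theorem add (hf : Rapid w f) (hg : Rapid w g) : Rapid w (f + g) := by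
  intro r
  obtain ⟨C, hC⟩ := hf r
  obtain ⟨C', hC'⟩ := hg r
  refine ⟨C + C', fun x => ?_⟩
  calc _ ≤ (1 + (w x : ℝ)) ^ r * (‖f x‖ + ‖g x‖) := by gcongr; exact norm_add_le _ _
    _ ≤ C + C' := by rw [mul_add]; exact add_le_add (hC x) (hC' x)

theorem smul (hf : Rapid w f) (z : ℂ) : Rapid w (z • f) := by
  intro r
  obtain ⟨C, hC⟩ := hf r
  refine ⟨‖z‖ * C, fun x => ?_⟩
  rw [Pi.smul_apply, smul_eq_mul, norm_mul, mul_left_comm]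
  exact mul_le_mul_of_nonneg_left (hC x) (norm_nonneg z)

theorem neg (hf : Rapid w f) : Rapid w (-f) := by
  simpa using hf.smul (-1)

theorem sub (hf : Rapid w f) (hg : Rapid w g) : Rapid w (f - g) := by
  rw [sub_eq_add_neg]; exact hf.add hg.neg

theorem comp (hf : Rapid w f) (φ : Y → X) : Rapid (w ∘ φ) (f ∘ φ) := fun r =>
  (hf r).imp fun _ hC y => hC (φ y)

/-- Multiplication by a function of polynomial growth and passage to a comparable weight. -/
theorem of_le (hf : Rapid w f) (A B : ℕ) (hw : ∀ x, g x ≠ 0 → 1 + w' x ≤ A * (1 + w x))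
    (hg : ∀ x, ‖g x‖ ≤ A * (1 + (w x : ℝ)) ^ B * ‖f x‖) : Rapid w' g := by
  intro r
  -- The B extra powers absorb the polynomial growth of `g` relative to `f`.
  obtain ⟨C, hC⟩ := hf (r + B)
  refine ⟨A ^ r * A * |C|, fun x => ?_⟩
  by_cases h0 : g x = 0
  · simp only [h0, norm_zero, mul_zero]; positivity
  have h1 : (1 + (w' x : ℝ)) ≤ A * (1 + (w x : ℝ)) := by exact_mod_cast hw x h0
  calc (1 + (w' x : ℝ)) ^ r * ‖g x‖
      ≤ (A * (1 + (w x : ℝ))) ^ r * (A * (1 + (w x : ℝ)) ^ B * ‖f x‖) := by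
        gcongr; exact hg x
    _ = A ^ r * A * ((1 + (w x : ℝ)) ^ (r + B) * ‖f x‖) := by rw [mul_pow]; ring
    _ ≤ A ^ r * A * |C| := by gcongr; exact (hC x).trans (le_abs_self C)

theorem of_weight_le (hf : Rapid w f) (A : ℕ) (hw : ∀ x, f x ≠ 0 → 1 + w' x ≤ A * (1 + w x)) :
    Rapid w' f := by
  refine hf.of_le (A + 1) 0 (fun x hx => (hw x hx).trans ?_) fun x => ?_
  · gcongr; omega
  · rw [pow_zero, mul_one]
    refine le_mul_of_one_le_left (norm_nonneg _) ?_
    push_cast; linarith [(Nat.cast_nonneg A : (0 : ℝ) ≤ A)]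

theorem of_norm_le (hf : Rapid w f) (A : ℕ) (hg : ∀ x, ‖g x‖ ≤ A * ‖f x‖) : Rapid w g := by
  refine hf.of_le (A + 1) 0 (fun x _ => ?_) fun x => ?_
  · nlinarith [Nat.zero_le (w x), Nat.zero_le A]
  · refine (hg x).trans ?_
    rw [pow_zero, mul_one]
    gcongr
    linarith

/-- A family decaying rapidly for two weights decays rapidly for their sum. -/
theorem add_weight (hf : Rapid w f) (hf' : Rapid w' f) : Rapid (fun x => w x + w' x) f := by
  intro r
  obtain ⟨C, hC⟩ := hf r
  obtain ⟨C', hC'⟩ := hf' r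
  refine ⟨2 ^ r * (C + C'), fun x => ?_⟩
  have h1 : (1 + ((w x + w' x : ℕ) : ℝ)) ≤ 2 * max (1 + (w x : ℝ)) (1 + (w' x : ℝ)) := by
    push_cast
    linarith [le_max_left (1 + (w x : ℝ)) (1 + (w' x : ℝ)),
      le_max_right (1 + (w x : ℝ)) (1 + (w' x : ℝ))]
  have h2 : (max (1 + (w x : ℝ)) (1 + (w' x : ℝ))) ^ r
      ≤ (1 + (w x : ℝ)) ^ r + (1 + (w' x : ℝ)) ^ r := by
    have ha : 0 ≤ (1 + (w x : ℝ)) ^ r := by positivity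
    have hb : 0 ≤ (1 + (w' x : ℝ)) ^ r := by positivity
    rcases max_choice (1 + (w x : ℝ)) (1 + (w' x : ℝ)) with h | h <;> rw [h] <;> linarith
  calc _ ≤ (2 * max (1 + (w x : ℝ)) (1 + (w' x : ℝ))) ^ r * ‖f x‖ := by gcongr
    _ ≤ 2 ^ r * ((1 + (w x : ℝ)) ^ r + (1 + (w' x : ℝ)) ^ r) * ‖f x‖ := by
        rw [mul_pow]; gcongr
    _ = 2 ^ r * ((1 + (w x : ℝ)) ^ r * ‖f x‖ + (1 + (w' x : ℝ)) ^ r * ‖f x‖) := by ring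
    _ ≤ _ := by gcongr; exacts [hC x, hC' x]

/-- Summation over antidiagonals. -/
theorem sum_antidiagonal {w : Y → ℕ} {F : Y × ℕ × ℕ → ℂ}
    (hF : Rapid (fun z => w z.1 + z.2.1 + z.2.2) F) :
    Rapid (fun z : Y × ℕ => w z.1 + z.2)
      (fun z => ∑ q ∈ Finset.HasAntidiagonal.antidiagonal z.2, F (z.1, q)) := by
  intro r
  -- The extra power pays for the n + 1 terms of the antidiagonal.
  obtain ⟨C, hC⟩ := hF (r + 1)
  refine ⟨C, fun ⟨y, n⟩ => ?_⟩
  simp only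
  have h0 : (0 : ℝ) < 1 + ((w y + n : ℕ) : ℝ) := by positivity
  have h1 : ∀ q ∈ Finset.HasAntidiagonal.antidiagonal n,
      ‖F (y, q)‖ ≤ C / (1 + ((w y + n : ℕ) : ℝ)) ^ (r + 1) := by
    intro q hq
    rw [Finset.HasAntidiagonal.mem_antidiagonal] at hq
    have := hC (y, q)
    simp only [add_assoc, hq] at this
    rw [le_div_iff₀ (by positivity), mul_comm]
    exact this
  have hC0 : 0 ≤ C / (1 + ((w y + n : ℕ) : ℝ)) ^ (r + 1) :=
    (norm_nonneg _).trans (h1 (0, n) (by simp))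
  calc _ ≤ (1 + ((w y + n : ℕ) : ℝ)) ^ r *
        ((n + 1) * (C / (1 + ((w y + n : ℕ) : ℝ)) ^ (r + 1))) := by
        gcongr
        refine (norm_sum_le_of_le _ h1).trans (le_of_eq ?_)
        simp
    _ ≤ (1 + ((w y + n : ℕ) : ℝ)) ^ r *
        ((1 + ((w y + n : ℕ) : ℝ)) * (C / (1 + ((w y + n : ℕ) : ℝ)) ^ (r + 1))) := by
        have : (n + 1 : ℝ) ≤ 1 + ((w y + n : ℕ) : ℝ) := by
          push_cast
          linarith [(Nat.cast_nonneg (w y) : (0 : ℝ) ≤ w y)]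
        exact mul_le_mul_of_nonneg_left (mul_le_mul_of_nonneg_right this hC0) (by positivity)
    _ = C := by
        rw [← mul_assoc, ← pow_succ]
        exact mul_div_cancel₀ _ (by positivity)

end Rapid

/-! ### Asymptotically polynomial sequences -/

/-- The `d`-th difference of the sequence is of rapid decay. -/
def AsympPoly : ℕ → (ℕ → ℂ) → Prop
  | 0, f => Rapid id f
  | d + 1, f => AsympPoly d fun n => f (n + 1) - f n

theorem AsympPoly.add {d : ℕ} : ∀ {f g : ℕ → ℂ}, AsympPoly d f → AsympPoly d g →
    AsympPoly d (fun n => f n + g n) := by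
  induction d with
  | zero => intro f g hf hg; exact Rapid.add hf hg
  | succ d ih =>
    intro f g hf hg
    have := ih hf hg
    simp only [AsympPoly]
    convert this using 2
    ring

theorem AsympPoly.sub {d : ℕ} : ∀ {f g : ℕ → ℂ}, AsympPoly d f → AsympPoly d g →
    AsympPoly d (fun n => f n - g n) := by
  induction d with
  | zero => intro f g hf hg; exact Rapid.sub hf hg
  | succ d ih =>
    intro f g hf hg
    have := ih hf hg
    simp only [AsympPoly]
    convert this using 2
    ring

/-- Boundary terms of differenced sums, and the half m < 0, appear with the index shifted by one;
this removes the shift. -/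
theorem asympPoly_comp_succ {d : ℕ} : ∀ {f : ℕ → ℂ},
    AsympPoly d (fun n => f (n + 1)) ↔ AsympPoly d f := by
  induction d with
  | zero =>
    intro f
    constructor
    · intro hf r
      obtain ⟨C, hC⟩ := hf r
      refine ⟨2 ^ r * |C| + ‖f 0‖, fun n => ?_⟩
      rcases n with _ | n
      · simp only [id, Nat.cast_zero, add_zero, one_pow, one_mul]
        have : 0 ≤ 2 ^ r * |C| := by positivity
        linarith
      · have h1 : (1 + ((n + 1 : ℕ) : ℝ)) ≤ 2 * (1 + (n : ℝ)) := by
          push_cast; linarith [(Nat.cast_nonneg n : (0 : ℝ) ≤ n)]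
        calc _ ≤ (2 * (1 + (n : ℝ))) ^ r * ‖f (n + 1)‖ := by simp only [id]; gcongr
          _ = 2 ^ r * ((1 + (n : ℝ)) ^ r * ‖f (n + 1)‖) := by rw [mul_pow]; ring
          _ ≤ 2 ^ r * |C| := by gcongr; exact (hC n).trans (le_abs_self C)
          _ ≤ _ := by linarith [norm_nonneg (f 0)]
    · intro hf
      exact (Rapid.comp hf (fun n : ℕ => n + 1)).of_weight_le 1 fun n _ => by simp
  | succ d ih =>
    intro f
    exact ih (f := fun n => f (n + 1) - f n)

theorem AsympPoly.succ {d : ℕ} {f : ℕ → ℂ} (hf : AsympPoly d f) : AsympPoly (d + 1) f :=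
  (asympPoly_comp_succ.2 hf).sub hf

theorem summable_nat_decay : Summable fun n : ℕ => ((1 + (n : ℝ)) ^ 2)⁻¹ := by
  have := (summable_nat_add_iff 1).2 (Real.summable_nat_pow_inv.2 (by norm_num : 1 < 2))
  simpa [add_comm] using this

/-- The increments are summable, so the sequence converges, and its distance to the limit is a tail
of a rapidly decaying series. -/
theorem AsympPoly.exists_limit {f : ℕ → ℂ} (hf : AsympPoly 1 f) :
    ∃ L : ℂ, Rapid id (fun n => f n - L) := by
  have hsum2 := summable_nat_decay
  have hs : Summable fun n => f (n + 1) - f n := by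
    obtain ⟨C, _, hC⟩ := Rapid.exists_bound (show Rapid id _ from hf) 2
    exact Summable.of_norm_bounded (hsum2.mul_left C) hC
  refine ⟨f 0 + ∑' n, (f (n + 1) - f n), fun r => ?_⟩
  -- In (1 + n + N)^(r+2), r powers are spent on decay in N and two on summability in n.
  obtain ⟨C, hC0, hC⟩ := Rapid.exists_bound (show Rapid id _ from hf) (r + 2)
  refine ⟨C * ∑' n : ℕ, ((1 + (n : ℝ)) ^ 2)⁻¹, fun N => ?_⟩
  have h1 : f N - (f 0 + ∑' n, (f (n + 1) - f n)) = -∑' n, (f (n + N + 1) - f (n + N)) := by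
    have := hs.sum_add_tsum_nat_add N
    rw [Finset.sum_range_sub] at this
    rw [← this]; ring
  have hb : ∀ n, ‖f (n + N + 1) - f (n + N)‖
      ≤ C * ((1 + (N : ℝ)) ^ r)⁻¹ * ((1 + (n : ℝ)) ^ 2)⁻¹ := by
    intro n
    refine (hC (n + N)).trans ?_
    rw [mul_assoc, ← mul_inv]
    refine mul_le_mul_of_nonneg_left (inv_anti₀ (by positivity) ?_) hC0
    rw [pow_add, id]
    push_cast
    have hn : (0 : ℝ) ≤ n := Nat.cast_nonneg n
    have hN : (0 : ℝ) ≤ N := Nat.cast_nonneg N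
    gcongr <;> linarith
  simp only [h1, norm_neg]
  calc _ ≤ (1 + (N : ℝ)) ^ r * (C * ((1 + (N : ℝ)) ^ r)⁻¹ * ∑' n : ℕ, ((1 + (n : ℝ)) ^ 2)⁻¹) := by
        simp only [id]
        gcongr
        rw [← tsum_mul_left]
        exact tsum_of_norm_bounded (hsum2.mul_left _).hasSum hb
    _ = _ := by
        have : (1 + (N : ℝ)) ^ r ≠ 0 := by positivity
        field_simp

/-- A sequence with third differences of rapid decay is a quadratic polynomial up to a sequence of
rapid decay. -/
theorem AsympPoly.exists_quadratic {f : ℕ → ℂ} (hf : AsympPoly 3 f) :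
    ∃ l₃ l₂ l₁ : ℂ, Rapid id (fun n => f n - (l₃ * n ^ 2 + l₂ * n + l₁)) := by
  -- Integrate three times: a is the limit of the second differences, b that of the first
  -- differences minus a n, and c the constant left over.
  obtain ⟨a, ha⟩ := AsympPoly.exists_limit (f := fun n => f (n + 2) - f (n + 1) - (f (n + 1) - f n))
    hf
  obtain ⟨b, hb⟩ := AsympPoly.exists_limit (f := fun n => f (n + 1) - f n - a * n) (by
    show Rapid id _
    convert ha using 2
    push_cast; ring)
  -- The polynomial is chosen so that its difference is a n + b.
  obtain ⟨c, hc⟩ := AsympPoly.exists_limit (f := fun n => f n - (a / 2 * n ^ 2 + (b - a / 2) * n))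
    (by
      show Rapid id _
      convert hb using 2
      push_cast; ring)
  refine ⟨a / 2, b - a / 2, c, ?_⟩
  convert hc using 2
  ring

/-! ### Sums over antidiagonals and simplices -/

/-- The sum of `h` over `a + b = n`. -/
def antiSum (h : ℕ → ℕ → ℂ) (n : ℕ) : ℂ := ∑ q ∈ Finset.HasAntidiagonal.antidiagonal n, h q.1 q.2

/-- The antidiagonal of n + 1 is that of n moved by one in the first variable, together with the
endpoint (0, n + 1). The companion `antiSum_succ'` moves the second variable. -/
theorem antiSum_succ (h : ℕ → ℕ → ℂ) (n : ℕ) : antiSum h (n + 1) - antiSum h n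
    = antiSum (fun a b => h (a + 1) b - h a b) n + h 0 (n + 1) := by
  simp only [antiSum, Finset.Nat.sum_antidiagonal_succ, Finset.sum_sub_distrib]
  ring

theorem antiSum_succ' (h : ℕ → ℕ → ℂ) (n : ℕ) : antiSum h (n + 1) - antiSum h n
    = antiSum (fun a b => h a (b + 1) - h a b) n + h (n + 1) 0 := by
  simp only [antiSum, Finset.Nat.sum_antidiagonal_succ', Finset.sum_sub_distrib]
  ring

theorem Rapid.antiSum {h : ℕ → ℕ → ℂ} (hh : Rapid (fun z : ℕ × ℕ => z.1 + z.2) fun z => h z.1 z.2) :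
    Rapid id (antiSum h) := by
  have h1 : Rapid (fun z : Unit × ℕ × ℕ => 0 + z.2.1 + z.2.2) fun z => h z.2.1 z.2.2 :=
    (hh.comp (fun z : Unit × ℕ × ℕ => z.2)).of_weight_le 1 fun z _ => by simp
  exact (h1.sum_antidiagonal (w := fun _ => 0)).comp (fun n : ℕ => ((), n)) |>.of_weight_le 1
    fun z _ => by simp

/-- Two-dimensional case: difference once in each variable. The mixed difference is a difference of
values of either hypothesis, so it decays in both variables; the endpoint terms are controlled by
one hypothesis each. -/
theorem asympPoly_antiSum {h : ℕ → ℕ → ℂ}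
    (h1 : Rapid (fun z : ℕ × ℕ => z.1) fun z => h (z.1 + 1) z.2 - h z.1 z.2)
    (h2 : Rapid (fun z : ℕ × ℕ => z.2) fun z => h z.1 (z.2 + 1) - h z.1 z.2) :
    AsympPoly 2 (antiSum h) := by
  show AsympPoly 1 fun n => antiSum h (n + 1) - antiSum h n
  simp only [antiSum_succ h]
  refine AsympPoly.add ?_ (asympPoly_comp_succ.2 ?_)
  · rw [AsympPoly, AsympPoly]
    simp only [antiSum_succ']
    refine Rapid.add ?_ ?_
    · refine Rapid.antiSum (Rapid.add_weight ?_ ?_)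
      · exact ((h1.comp fun z : ℕ × ℕ => (z.1, z.2 + 1)).of_weight_le 1 fun z _ => by simp).sub h1
      · convert ((h2.comp fun z : ℕ × ℕ => (z.1 + 1, z.2)).of_weight_le 1
          fun z _ => by simp).sub h2 using 1
        ext z
        simp only [Pi.sub_apply, Function.comp]
        ring
    · exact (h1.comp fun n : ℕ => (n + 1, 0)).of_weight_le 1 fun z _ => by simp
  · exact (h2.comp fun n : ℕ => (0, n)).of_weight_le 1 fun z _ => by simp

/-- Here `H a n` will be the sum of `g a` over b + c = n. One difference in the first slot and two
in the second leave the interior term `h3`; the boundary terms met on the way are those of `h0`,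
`h1` and `h2`. -/
theorem asympPoly_antiSum_three {H : ℕ → ℕ → ℂ} (h0 : AsympPoly 2 (H 0))
    (h1 : Rapid id fun n => H (n + 1) 0 - H n 0)
    (h2 : Rapid id fun n => H (n + 1) 1 - H n 1)
    (h3 : Rapid (fun z : ℕ × ℕ => z.1 + z.2)
      fun z => (H (z.1 + 1) (z.2 + 2) - H z.1 (z.2 + 2) - (H (z.1 + 1) (z.2 + 1) - H z.1 (z.2 + 1)))
        - (H (z.1 + 1) (z.2 + 1) - H z.1 (z.2 + 1) - (H (z.1 + 1) z.2 - H z.1 z.2))) :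
    AsympPoly 3 (antiSum H) := by
  have h1' := asympPoly_comp_succ.2 (show AsympPoly 0 _ from h1)
  have h2' := asympPoly_comp_succ.2 (show AsympPoly 0 _ from h2)
  show AsympPoly 2 fun n => antiSum H (n + 1) - antiSum H n
  simp only [antiSum_succ H]
  refine AsympPoly.add ?_ (asympPoly_comp_succ.2 h0)
  rw [AsympPoly]
  simp only [antiSum_succ']
  refine AsympPoly.add ?_ (AsympPoly.succ h1')
  rw [AsympPoly]
  simp only [antiSum_succ']
  exact Rapid.add h3.antiSum (h2'.sub h1')

/-- The sum of `g` over `a + b + c = n`. -/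
def simplexSum (g : ℕ → ℕ → ℕ → ℂ) (n : ℕ) : ℂ := antiSum (fun a => antiSum (g a)) n

theorem asympPoly_simplexSum {g : ℕ → ℕ → ℕ → ℂ}
    (h1 : Rapid (fun z : ℕ × ℕ × ℕ => z.1)
      fun z => g (z.1 + 1) z.2.1 z.2.2 - g z.1 z.2.1 z.2.2)
    (h2 : Rapid (fun z : ℕ × ℕ × ℕ => z.2.1)
      fun z => g z.1 (z.2.1 + 1) z.2.2 - g z.1 z.2.1 z.2.2)
    (h3 : Rapid (fun z : ℕ × ℕ × ℕ => z.2.2)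
      fun z => g z.1 z.2.1 (z.2.2 + 1) - g z.1 z.2.1 z.2.2) :
    AsympPoly 3 (simplexSum g) := by
  -- Each further difference adds a variable to the weight: G decays in a, its b- and c-differences
  -- in (a, b) and (a, c), and the mixed third difference in all three.
  set G : ℕ → ℕ → ℕ → ℂ := fun a b c => g (a + 1) b c - g a b c with hG
  have hG1 : Rapid (fun z : ℕ × ℕ × ℕ => z.1) fun z => G z.1 z.2.1 z.2.2 := h1
  have hG2 : Rapid (fun z : ℕ × ℕ × ℕ => z.1 + z.2.1)
      fun z => G z.1 (z.2.1 + 1) z.2.2 - G z.1 z.2.1 z.2.2 := by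
    refine Rapid.add_weight ?_ ?_
    · exact ((h1.comp fun z : ℕ × ℕ × ℕ => (z.1, z.2.1 + 1, z.2.2)).of_weight_le 1
        fun z _ => by simp).sub h1
    · convert ((h2.comp fun z : ℕ × ℕ × ℕ => (z.1 + 1, z.2)).of_weight_le 1
        fun z _ => by simp).sub h2 using 1
      ext z
      simp only [Pi.sub_apply, Function.comp, hG]
      ring
  have hG3 : Rapid (fun z : ℕ × ℕ × ℕ => z.1 + z.2.2)
      fun z => G z.1 z.2.1 (z.2.2 + 1) - G z.1 z.2.1 z.2.2 := by
    refine Rapid.add_weight ?_ ?_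
    · exact ((h1.comp fun z : ℕ × ℕ × ℕ => (z.1, z.2.1, z.2.2 + 1)).of_weight_le 1
        fun z _ => by simp).sub h1
    · convert ((h3.comp fun z : ℕ × ℕ × ℕ => (z.1 + 1, z.2)).of_weight_le 1
        fun z _ => by simp).sub h3 using 1
      ext z
      simp only [Pi.sub_apply, Function.comp, hG]
      ring
  set G' : ℕ → ℕ → ℕ → ℂ := fun a b c => G a (b + 1) c - G a b c with hG'
  have hG23 : Rapid (fun z : ℕ × ℕ × ℕ => z.1 + z.2.1 + z.2.2)
      fun z => G' z.1 z.2.1 (z.2.2 + 1) - G' z.1 z.2.1 z.2.2 := by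
    have a : Rapid (fun z : ℕ × ℕ × ℕ => z.1 + z.2.1)
        fun z => G' z.1 z.2.1 (z.2.2 + 1) - G' z.1 z.2.1 z.2.2 :=
      ((hG2.comp fun z : ℕ × ℕ × ℕ => (z.1, z.2.1, z.2.2 + 1)).of_weight_le 1
        fun z _ => by simp).sub hG2
    have b : Rapid (fun z : ℕ × ℕ × ℕ => z.1 + z.2.2)
        fun z => G' z.1 z.2.1 (z.2.2 + 1) - G' z.1 z.2.1 z.2.2 := by
      convert ((hG3.comp fun z : ℕ × ℕ × ℕ => (z.1, z.2.1 + 1, z.2.2)).of_weight_le 1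
        fun z _ => by simp).sub hG3 using 1
      ext z
      simp only [Pi.sub_apply, Function.comp, hG']
      ring
    exact (a.add_weight b).of_weight_le 1 fun z _ => by omega
  have e1 : ∀ a n, antiSum (g (a + 1)) n - antiSum (g a) n = antiSum (G a) n := by
    intro a n; simp only [antiSum, hG, Finset.sum_sub_distrib]
  have e2 : ∀ a n, antiSum (G a) (n + 1) - antiSum (G a) n = antiSum (G' a) n + G a 0 (n + 1) :=
    fun a n => antiSum_succ (G a) n
  have e3 : ∀ a n, antiSum (G' a) (n + 1) - antiSum (G' a) n
      = antiSum (fun b c => G' a b (c + 1) - G' a b c) n + G' a (n + 1) 0 :=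
    fun a n => antiSum_succ' (G' a) n
  refine asympPoly_antiSum_three (asympPoly_antiSum ?_ ?_) ?_ ?_ ?_
  · exact (h2.comp fun z : ℕ × ℕ => (0, z.1, z.2)).of_weight_le 1 fun z _ => by simp
  · exact (h3.comp fun z : ℕ × ℕ => (0, z.1, z.2)).of_weight_le 1 fun z _ => by simp
  · have h : Rapid id fun n => G n 0 0 :=
      (hG1.comp fun n : ℕ => (n, 0, 0)).of_weight_le 1 fun z _ => by simp
    convert h using 2
    rw [e1]; simp [antiSum]
  · have h : Rapid id fun n => G n 0 1 + G n 1 0 := by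
      refine Rapid.add (w := id) (f := fun n => G n 0 1) (g := fun n => G n 1 0) ?_ ?_
      · exact (hG1.comp fun n : ℕ => (n, 0, 1)).of_weight_le 1 fun z _ => by simp
      · exact (hG1.comp fun n : ℕ => (n, 1, 0)).of_weight_le 1 fun z _ => by simp
    convert h using 2
    rw [e1]; simp [antiSum, Finset.Nat.antidiagonal_succ]
  · simp only [e1]
    have a : Rapid (fun z : ℕ × ℕ => z.1 + z.2)
        fun z => antiSum (fun b c => G' z.1 b (c + 1) - G' z.1 b c) z.2 :=
      Rapid.sum_antidiagonal (w := fun a : ℕ => a)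
        (F := fun z => G' z.1 z.2.1 (z.2.2 + 1) - G' z.1 z.2.1 z.2.2) hG23
    have b : Rapid (fun z : ℕ × ℕ => z.1 + z.2) fun z => G' z.1 (z.2 + 1) 0 :=
      (hG2.comp fun z : ℕ × ℕ => (z.1, z.2 + 1, 0)).of_weight_le 1
        fun z _ => by simp only [Function.comp]; omega
    have c : Rapid (fun z : ℕ × ℕ => z.1 + z.2)
        fun z => G z.1 0 (z.2 + 1 + 1) - G z.1 0 (z.2 + 1) :=
      (hG3.comp fun z : ℕ × ℕ => (z.1, 0, z.2 + 1)).of_weight_le 1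
        fun z _ => by simp only [Function.comp]; omega
    -- The second difference in n is taken once along b and once along c: an interior sum, plus the
    -- edges c = 0 and b = 0.
    have e : ∀ z : ℕ × ℕ, antiSum (G z.1) (z.2 + 2) - antiSum (G z.1) (z.2 + 1)
        - (antiSum (G z.1) (z.2 + 1) - antiSum (G z.1) z.2)
        = antiSum (fun b c => G' z.1 b (c + 1) - G' z.1 b c) z.2 + G' z.1 (z.2 + 1) 0
          + (G z.1 0 (z.2 + 1 + 1) - G z.1 0 (z.2 + 1)) := by
      intro z
      rw [← e3, e2 z.1 z.2, e2 z.1 (z.2 + 1)]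
      ring
    simp only [e]
    exact (a.add b).add c

/-! ### Kernels on the lattice `ℤ³` -/

/-- Points of the lattice `ℤ³`; the label `(N, x, y)` corresponds to the point
`(min x y, x - y, N - max x y)`. -/
abbrev Pt : Type := Fin 3 → ℤ

/-- The `ℓ¹` distance. -/
def offDiag (z : Pt × Pt) : ℕ :=
  (z.1 0 - z.2 0).natAbs + (z.1 1 - z.2 1).natAbs + (z.1 2 - z.2 2).natAbs

/-- The diagonal translation by the `i`-th unit vector. -/
def shift (i : Fin 3) (z : Pt × Pt) : Pt × Pt := (z.1 + Pi.single i 1, z.2 + Pi.single i 1)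

/-- The increment of a kernel under diagonal translation. -/
def shiftDiff (i : Fin 3) (K : Pt × Pt → ℂ) (z : Pt × Pt) : ℂ := K (shift i z) - K z

/-- The distance from the diagonal plus the modulus of the `i`-th coordinate. -/
def dirWeight (i : Fin 3) (z : Pt × Pt) : ℕ := offDiag z + (z.1 i).natAbs

/-- Kernels of rapid decay off the diagonal, which are asymptotically invariant under translation
in each of the three directions. -/
structure SmoothKernel (K : Pt × Pt → ℂ) : Prop where
  rapid : Rapid offDiag K
  diff : ∀ i, Rapid (dirWeight i) (shiftDiff i K)

/-- The product of kernels. -/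
def convKer (K L : Pt × Pt → ℂ) (z : Pt × Pt) : ℂ := ∑' s, K (z.1, s) * L (s, z.2)

theorem offDiag_shift (i : Fin 3) (z : Pt × Pt) : offDiag (shift i z) = offDiag z := by
  simp [offDiag, shift]

theorem natAbs_sub_le_offDiag (i : Fin 3) (z : Pt × Pt) : (z.1 i - z.2 i).natAbs ≤ offDiag z := by
  unfold offDiag
  fin_cases i <;> simp <;> omega

theorem offDiag_triangle (p s q : Pt) : offDiag (p, q) ≤ offDiag (p, s) + offDiag (s, q) := by
  simp only [offDiag]
  omega

theorem Rapid.shift {K : Pt × Pt → ℂ} (hK : Rapid offDiag K) (i : Fin 3) :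
    Rapid offDiag (K ∘ shift i) :=
  (hK.comp (QuantumSU2.shift i)).of_weight_le 1 fun z _ => by
    simp only [Function.comp, offDiag_shift]; omega

theorem Rapid.shiftDiff {K : Pt × Pt → ℂ} (hK : Rapid offDiag K) (i : Fin 3) :
    Rapid offDiag (shiftDiff i K) :=
  (hK.shift i).sub hK

theorem Rapid.shiftDiff_of_support {K : Pt × Pt → ℂ} (hK : Rapid offDiag K) {i : Fin 3}
    (h : ∀ z, QuantumSU2.shiftDiff i K z ≠ 0 → (z.1 i).natAbs ≤ offDiag z + 1) :
    Rapid (dirWeight i) (QuantumSU2.shiftDiff i K) :=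
  (hK.shiftDiff i).of_weight_le 2 fun z hz => by
    have := h z hz
    simp only [dirWeight]; omega

theorem summable_int_decay : Summable fun n : ℤ => ((1 + (n.natAbs : ℝ)) ^ 2)⁻¹ := by
  have h := summable_nat_decay
  exact Summable.of_nat_of_neg (by simpa using h) (by simpa using h)

theorem summable_decay :
    Summable fun p : Pt => ((1 + (offDiag (p, 0) : ℝ)) ^ 6)⁻¹ := by
  have h := (summable_int_decay.mul_of_nonneg (summable_int_decay.mul_of_nonneg summable_int_decay
    (fun _ => by positivity) (fun _ => by positivity))
    (fun _ => by positivity) (fun _ => by positivity)).comp_injective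
    (i := fun p : Pt => (p 0, p 1, p 2)) (by
      intro p q hpq
      simp only [Prod.mk.injEq] at hpq
      funext i
      fin_cases i
      exacts [hpq.1, hpq.2.1, hpq.2.2])
  refine h.of_nonneg_of_le (fun _ => by positivity) fun p => ?_
  simp only [Function.comp, ← mul_inv]
  refine inv_anti₀ (by positivity) ?_
  have e : ∀ j, (1 + ((p j).natAbs : ℝ)) ≤ 1 + (offDiag (p, 0) : ℝ) := by
    intro j
    have := natAbs_sub_le_offDiag j (p, 0)
    simp only [Pi.zero_apply, sub_zero] at this
    have : ((p j).natAbs : ℝ) ≤ offDiag (p, 0) := by exact_mod_cast this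
    linarith
  calc _ ≤ (1 + (offDiag (p, 0) : ℝ)) ^ 2 * ((1 + (offDiag (p, 0) : ℝ)) ^ 2
        * (1 + (offDiag (p, 0) : ℝ)) ^ 2) :=
        mul_le_mul (pow_le_pow_left₀ (by positivity) (e 0) 2)
          (mul_le_mul (pow_le_pow_left₀ (by positivity) (e 1) 2)
            (pow_le_pow_left₀ (by positivity) (e 2) 2) (by positivity) (by positivity))
          (by positivity) (by positivity)
    _ = _ := by ring

theorem summable_offDiag (q : Pt) :
    Summable fun s : Pt => ((1 + (offDiag (s, q) : ℝ)) ^ 6)⁻¹ := by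
  have := (Equiv.subRight q).summable_iff.2 summable_decay
  refine this.congr fun s => ?_
  simp [offDiag]

theorem tsum_offDiag (q : Pt) : ∑' s : Pt, ((1 + (offDiag (s, q) : ℝ)) ^ 6)⁻¹
    = ∑' s : Pt, ((1 + (offDiag (s, 0) : ℝ)) ^ 6)⁻¹ := by
  rw [← (Equiv.subRight q).tsum_eq fun s : Pt => ((1 + (offDiag (s, 0) : ℝ)) ^ 6)⁻¹]
  simp [offDiag]

theorem summable_convKer {K L : Pt × Pt → ℂ} (hK : Rapid offDiag K) (hL : Rapid offDiag L)
    (z : Pt × Pt) : Summable fun s => K (z.1, s) * L (s, z.2) := by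
  obtain ⟨C, hC⟩ := hK.exists_le
  obtain ⟨C', hC'0, hC'⟩ := hL.exists_bound 6
  refine Summable.of_norm_bounded (((summable_offDiag z.2).mul_left C').mul_left C) fun s => ?_
  rw [norm_mul]
  exact mul_le_mul (hC _) (hC' _) (norm_nonneg _) ((norm_nonneg _).trans (hC (z.1, s)))

/-- A triangle inequality between the three weights gives 1 + w'' ≤ 2 (1 + w)(1 + w'), so decay
passes to the product. Six more powers of the second factor make the sum over ℤ³ converge, two for
each coordinate. -/
theorem Rapid.convKer {K L : Pt × Pt → ℂ} {w w' w'' : Pt × Pt → ℕ} (hK : Rapid w K)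
    (hL : Rapid w' L) (hw : ∀ p s q, w'' (p, q) ≤ 2 * (w (p, s) + w' (s, q)))
    (hw' : ∀ z, offDiag z ≤ w' z) : Rapid w'' (convKer K L) := by
  intro r
  obtain ⟨C, hC0, hC⟩ := hK.exists_bound r
  obtain ⟨C', hC'0, hC'⟩ := hL.exists_bound (r + 6)
  refine ⟨2 ^ r * C * C' * ∑' s : Pt, ((1 + (offDiag (s, 0) : ℝ)) ^ 6)⁻¹, fun ⟨p, q⟩ => ?_⟩
  have hW : (0 : ℝ) < (1 + (w'' (p, q) : ℝ)) ^ r := by positivity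
  have hb : ∀ s, ‖K (p, s) * L (s, q)‖ ≤
      2 ^ r * C * C' * ((1 + (w'' (p, q) : ℝ)) ^ r)⁻¹ * ((1 + (offDiag (s, q) : ℝ)) ^ 6)⁻¹ := by
    intro s
    have h1 : (1 + (w'' (p, q) : ℝ)) ≤ 2 * ((1 + (w (p, s) : ℝ)) * (1 + (w' (s, q) : ℝ))) := by
      have : (w'' (p, q) : ℝ) ≤ 2 * (w (p, s) + w' (s, q)) := by exact_mod_cast hw p s q
      have : (0 : ℝ) ≤ w (p, s) * w' (s, q) := by positivity
      nlinarith
    have h2 : (1 + (offDiag (s, q) : ℝ)) ≤ 1 + (w' (s, q) : ℝ) := by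
      have : (offDiag (s, q) : ℝ) ≤ w' (s, q) := by exact_mod_cast hw' (s, q)
      linarith
    rw [norm_mul]
    refine (mul_le_mul (hC (p, s)) (hC' (s, q)) (norm_nonneg _) (by positivity)).trans ?_
    have h3 : ((1 + (w (p, s) : ℝ)) ^ r)⁻¹ * ((1 + (w' (s, q) : ℝ)) ^ r)⁻¹
        ≤ 2 ^ r * ((1 + (w'' (p, q) : ℝ)) ^ r)⁻¹ := by
      rw [← mul_inv, ← mul_pow, ← div_eq_mul_inv, le_div_iff₀ hW, inv_mul_le_iff₀ (by positivity),
        ← mul_pow, mul_comm _ (2 : ℝ)]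
      gcongr
    have h4 : ((1 + (w' (s, q) : ℝ)) ^ 6)⁻¹ ≤ ((1 + (offDiag (s, q) : ℝ)) ^ 6)⁻¹ :=
      inv_anti₀ (by positivity) (by gcongr)
    calc C * ((1 + (w (p, s) : ℝ)) ^ r)⁻¹ * (C' * ((1 + (w' (s, q) : ℝ)) ^ (r + 6))⁻¹)
        = C * C' * (((1 + (w (p, s) : ℝ)) ^ r)⁻¹ * ((1 + (w' (s, q) : ℝ)) ^ r)⁻¹)
          * ((1 + (w' (s, q) : ℝ)) ^ 6)⁻¹ := by rw [pow_add, mul_inv]; ring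
      _ ≤ C * C' * (2 ^ r * ((1 + (w'' (p, q) : ℝ)) ^ r)⁻¹)
          * ((1 + (offDiag (s, q) : ℝ)) ^ 6)⁻¹ := by gcongr
      _ = _ := by ring
  have h5 := tsum_of_norm_bounded ((summable_offDiag q).mul_left _).hasSum hb
  rw [tsum_mul_left, tsum_offDiag] at h5
  rw [QuantumSU2.convKer]
  calc _ ≤ _ := mul_le_mul_of_nonneg_left h5 hW.le
    _ = _ := by
      rw [← mul_assoc]
      congr 1
      field_simp

/-- Leibniz rule: the intermediate point runs over the whole lattice, so it can be translated along
with the endpoints. This is why kernels are extended by zero to ℤ³. -/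
theorem shiftDiff_convKer {K L : Pt × Pt → ℂ} (hK : Rapid offDiag K) (hL : Rapid offDiag L)
    (i : Fin 3) : shiftDiff i (convKer K L)
      = convKer (shiftDiff i K) (L ∘ shift i) + convKer K (shiftDiff i L) := by
  ext z
  have h1 : convKer K L (shift i z)
      = ∑' s, (K ∘ shift i) (z.1, s) * (L ∘ shift i) (s, z.2) := by
    rw [convKer, ← (Equiv.addRight (Pi.single i 1 : Pt)).tsum_eq]
    rfl
  rw [shiftDiff, h1, Pi.add_apply, convKer, convKer, convKer,
    ← (summable_convKer (hK.shift i) (hL.shift i) z).tsum_sub (summable_convKer hK hL z),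
    ← (summable_convKer (hK.shiftDiff i) (hL.shift i) z).tsum_add
      (summable_convKer hK (hL.shiftDiff i) z)]
  congr 1
  ext s
  simp only [shiftDiff, Function.comp]
  ring

namespace SmoothKernel

variable {K L : Pt × Pt → ℂ}

theorem add (hK : SmoothKernel K) (hL : SmoothKernel L) : SmoothKernel (K + L) where
  rapid := hK.rapid.add hL.rapid
  diff i := by
    convert (hK.diff i).add (hL.diff i) using 1
    ext z
    simp only [shiftDiff, Pi.add_apply]; ring

theorem smul (hK : SmoothKernel K) (c : ℂ) : SmoothKernel (c • K) where
  rapid := hK.rapid.smul c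
  diff i := by
    convert (hK.diff i).smul c using 1
    ext z
    simp only [shiftDiff, Pi.smul_apply, smul_eq_mul]; ring

theorem conv (hK : SmoothKernel K) (hL : SmoothKernel L) : SmoothKernel (convKer K L) where
  rapid := hK.rapid.convKer hL.rapid
    (fun p s q => (offDiag_triangle p s q).trans (by omega)) fun z => le_rfl
  diff i := by
    rw [shiftDiff_convKer hK.rapid hL.rapid]
    refine Rapid.add ?_ ?_
    · refine (hK.diff i).convKer (hL.rapid.shift i) (fun p s q => ?_) fun z => le_rfl
      have := offDiag_triangle p s q
      simp only [dirWeight]; omega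
    -- The decay is in the coordinate of the intermediate point s; it passes to p because |p_i| ≤
    -- |s_i| + d(p, s).
    · refine hK.rapid.convKer (hL.diff i) (fun p s q => ?_) fun z => Nat.le_add_right _ _
      have := offDiag_triangle p s q
      have := natAbs_sub_le_offDiag i (p, s)
      simp only [dirWeight] at this ⊢; omega

/-- Kernels decaying rapidly in all directions. -/
theorem of_rapid (h : Rapid (fun z => offDiag z + (z.1 0).natAbs + (z.1 1).natAbs
    + (z.1 2).natAbs) K) : SmoothKernel K where
  rapid := h.of_weight_le 1 fun z _ => by omega
  diff i := by
    refine Rapid.sub ?_ ?_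
    · refine (h.comp (shift i)).of_weight_le 2 fun z _ => ?_
      simp only [Function.comp, offDiag_shift, dirWeight]
      simp only [shift]
      fin_cases i <;> simp <;> omega
    · refine h.of_weight_le 2 fun z _ => ?_
      simp only [dirWeight]
      fin_cases i <;> simp <;> omega

/-- Multiplication on the left by a bounded function which changes in each direction only near
the origin. -/
theorem mul_left (hK : SmoothKernel K) (χ : Pt → ℂ) (hχ : ∀ p, ‖χ p‖ ≤ 1)
    (hχ' : ∀ i p, χ (p + Pi.single i 1) ≠ χ p → (p i).natAbs ≤ 1) :
    SmoothKernel fun z => χ z.1 * K z where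
  rapid := hK.rapid.of_norm_le 1 fun z => by
    rw [norm_mul]; gcongr; simpa using hχ z.1
  diff i := by
    have e : shiftDiff i (fun z => χ z.1 * K z) = (fun z => χ (z.1 + Pi.single i 1) * shiftDiff i K z)
        + fun z => (χ (z.1 + Pi.single i 1) - χ z.1) * K z := by
      ext z
      simp only [shiftDiff, shift, Pi.add_apply]; ring
    rw [e]
    refine Rapid.add ?_ ?_
    · exact (hK.diff i).of_norm_le 1 fun z => by
        rw [norm_mul]; gcongr; simpa using hχ _
    · refine hK.rapid.of_le 2 0 (fun z hz => ?_) fun z => ?_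
      · have := hχ' i z.1 (fun h => hz (by simp [h]))
        simp only [dirWeight]; omega
      · rw [norm_mul, pow_zero, mul_one]
        gcongr
        have h1 := hχ z.1
        have h2 := hχ (z.1 + Pi.single i 1)
        have := norm_sub_le (χ (z.1 + Pi.single i 1)) (χ z.1)
        push_cast; linarith

end SmoothKernel

/-! ### Multiplication by differences of lengths -/

/-- The extension of the length function `(k, m, c) ↦ k + |m| + c` to the lattice. -/
def ptLength (p : Pt) : ℤ := p 0 + (p 1).natAbs + p 2

theorem norm_intCast_eq_natAbs (n : ℤ) : ‖(n : ℂ)‖ = n.natAbs := by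
  rw [Complex.norm_intCast, ← Int.cast_abs, Int.abs_eq_natAbs, Int.cast_natCast]

theorem natAbs_ptLength_sub_le (z : Pt × Pt) :
    (ptLength z.1 - ptLength z.2).natAbs ≤ offDiag z := by
  simp only [ptLength, offDiag]
  omega

/-- The length is 1-Lipschitz, so the factor costs one power of the distance to the diagonal. It is
invariant under diagonal translation except when the m-coordinates lie on opposite sides of 0, and
then |m| is at most the distance to the diagonal. -/
theorem SmoothKernel.mul_ptLength {K : Pt × Pt → ℂ} (hK : SmoothKernel K) :
    SmoothKernel fun z => ((ptLength z.1 - ptLength z.2 : ℤ) : ℂ) * K z where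
  rapid := by
    refine hK.rapid.of_le 1 1 (fun z _ => by omega) fun z => ?_
    rw [norm_mul]
    gcongr
    have : ((ptLength z.1 - ptLength z.2).natAbs : ℝ) ≤ offDiag z := by
      exact_mod_cast natAbs_ptLength_sub_le z
    rw [norm_intCast_eq_natAbs]
    push_cast
    linarith
  diff i := by
    have e : shiftDiff i (fun z => ((ptLength z.1 - ptLength z.2 : ℤ) : ℂ) * K z)
        = (fun z => ((ptLength (shift i z).1 - ptLength (shift i z).2 : ℤ) : ℂ) * shiftDiff i K z)
        + fun z => ((ptLength (shift i z).1 - ptLength (shift i z).2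
          - (ptLength z.1 - ptLength z.2) : ℤ) : ℂ) * K z := by
      ext z
      simp only [shiftDiff, Pi.add_apply]; push_cast; ring
    rw [e]
    refine Rapid.add ?_ ?_
    · refine (hK.diff i).of_le 1 1 (fun z _ => by omega) fun z => ?_
      rw [norm_mul]
      gcongr
      have : ((ptLength (shift i z).1 - ptLength (shift i z).2).natAbs : ℝ) ≤ dirWeight i z := by
        have := natAbs_ptLength_sub_le (shift i z)
        rw [offDiag_shift] at this
        exact_mod_cast this.trans (Nat.le_add_right _ _)
      rw [norm_intCast_eq_natAbs]
      push_cast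
      linarith
    · refine hK.rapid.of_le 2 0 (fun z hz => ?_) fun z => ?_
      · have h1 : ptLength (shift i z).1 - ptLength (shift i z).2
            - (ptLength z.1 - ptLength z.2) ≠ 0 := fun h => hz (by simp [h])
        simp only [dirWeight, offDiag]
        revert h1
        fin_cases i <;> simp [ptLength, shift, -Nat.cast_natAbs] <;> omega
      · rw [norm_mul, pow_zero, mul_one]
        gcongr
        have h1 : (ptLength (shift i z).1 - ptLength (shift i z).2
            - (ptLength z.1 - ptLength z.2)).natAbs ≤ 2 := by
          fin_cases i <;> simp [ptLength, shift, -Nat.cast_natAbs] <;> omega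
        rw [norm_intCast_eq_natAbs]
        exact_mod_cast h1

/-! ### Matrix coefficients -/

theorem inner_e (i : Idx) (ξ : H) : ⟪e i, ξ⟫_ℂ = ξ i := by
  classical
  rw [e, lp.inner_single_left]
  simp

theorem hasSum_e (ξ : H) : HasSum (fun i => ξ i • e i) ξ := by
  classical
  convert lp.hasSum_single (p := 2) (by norm_num) ξ using 2 with i
  rw [e, ← lp.single_smul]
  simp

theorem hasSum_coeff (T : H →L[ℂ] H) (ξ : H) (i : Idx) :
    HasSum (fun j => T (e j) i * ξ j) (T ξ i) := by
  have h := ((hasSum_e ξ).mapL T).mapL (lp.evalCLM ℂ (fun _ : Idx => ℂ) (p := 2) i)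
  have e : (fun j => T (e j) i * ξ j)
      = fun j => lp.evalCLM ℂ (fun _ : Idx => ℂ) 2 i (T (ξ j • e j)) := by
    funext j
    rw [map_smul, map_smul, smul_eq_mul, mul_comm]
    rfl
  rw [e]
  exact h

theorem mem_diagOp_domain {w : Idx → ℂ} {ξ : H} :
    ξ ∈ (diagOp w).domain ↔ Memℓp (fun i => w i * ξ i) 2 := Iff.rfl

theorem diagOp_apply (w : Idx → ℂ) (ξ : (diagOp w).domain) (i : Idx) :
    diagOp w ξ i = w i * (ξ : H) i := rfl

theorem e_mem_diagOp_domain (w : Idx → ℂ) (j : Idx) : e j ∈ (diagOp w).domain := by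
  rw [mem_diagOp_domain]
  have h := lp.memℓp (w j • e j)
  convert h using 2 with i
  rw [lp.coeFn_smul, Pi.smul_apply, smul_eq_mul, e_apply]
  split_ifs with hij
  · rw [hij]
  · simp

theorem diagOp_e (w : Idx → ℂ) (j : Idx) :
    diagOp w ⟨e j, e_mem_diagOp_domain w j⟩ = w j • e j := by
  refine H_ext fun i => ?_
  rw [diagOp_apply, lp.coeFn_smul, Pi.smul_apply, smul_eq_mul, e_apply]
  split_ifs with hij
  · rw [hij]
  · simp

/-- Reduces unbounded commutators to matrix entries. No separate domain condition is needed: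
expanding T ξ in the basis gives w · T ξ = S ξ + T (w · ξ), which is square summable, and the domain
is maximal. -/
theorem isCommutator_diagOp {w : Idx → ℂ} {T S : H →L[ℂ] H} :
    IsCommutator (diagOp w) T S ↔ ∀ i j, S (e j) i = (w i - w j) * T (e j) i := by
  constructor
  · intro h i j
    obtain ⟨hm, hS⟩ := h ⟨e j, e_mem_diagOp_domain w j⟩
    rw [← hS, diagOp_e, map_smul, lp.coeFn_sub, Pi.sub_apply, diagOp_apply, lp.coeFn_smul,
      Pi.smul_apply, smul_eq_mul]
    ring
  · intro h ξ
    have key : ∀ i, w i * T (ξ : H) i = (S (ξ : H) + T (diagOp w ξ)) i := by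
      intro i
      have h1 := (hasSum_coeff T (ξ : H) i).mul_left (w i)
      have h2 := (hasSum_coeff S (ξ : H) i).add (hasSum_coeff T (diagOp w ξ) i)
      rw [lp.coeFn_add, Pi.add_apply]
      have e : (fun j => w i * (T (e j) i * (ξ : H) j))
          = fun j => S (e j) i * (ξ : H) j + T (e j) i * diagOp w ξ j := by
        funext j
        rw [h, diagOp_apply]
        ring
      rw [e] at h1
      exact h1.unique h2
    have hm : T (ξ : H) ∈ (diagOp w).domain := by
      rw [mem_diagOp_domain]
      simp only [key]
      exact lp.memℓp _
    refine ⟨hm, H_ext fun i => ?_⟩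
    rw [lp.coeFn_sub, Pi.sub_apply, diagOp_apply]
    simp only [key]
    simp

/-! ### The kernel of an operator -/

/-- The lattice point corresponding to a label. -/
def Idx.toPt (t : Idx) : Pt := ![min t.x t.y, t.x - t.y, t.N - max t.x t.y]

/-- The lattice points corresponding to labels. -/
def IsLabel (p : Pt) : Prop := 0 ≤ p 0 ∧ 0 ≤ p 2

instance : DecidablePred IsLabel := fun p => inferInstanceAs (Decidable (0 ≤ p 0 ∧ 0 ≤ p 2))

/-- The label of a lattice point. -/
def ptIdx (p : Pt) : Idx :=
  ⟨(p 0).toNat + (p 1).natAbs + (p 2).toNat, (p 0).toNat + (p 1).toNat,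
    (p 0).toNat + (-p 1).toNat, by omega, by omega⟩

theorem ptIdx_toPt (t : Idx) : ptIdx t.toPt = t := by
  obtain ⟨N, x, y, hx, hy⟩ := t
  simp only [ptIdx, Idx.toPt, Idx.mk.injEq]
  simp [-Nat.cast_max, -Nat.cast_min]
  omega

theorem toPt_ptIdx {p : Pt} (hp : IsLabel p) : (ptIdx p).toPt = p := by
  obtain ⟨h0, h2⟩ := hp
  funext i
  fin_cases i <;> simp [ptIdx, Idx.toPt, -Nat.cast_natAbs] <;> omega

theorem isLabel_toPt (t : Idx) : IsLabel t.toPt := by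
  obtain ⟨N, x, y, hx, hy⟩ := t
  constructor
  · simp [Idx.toPt]
  · simp [Idx.toPt]; omega

theorem toPt_injective : Function.Injective Idx.toPt :=
  Function.LeftInverse.injective ptIdx_toPt

theorem ptLength_toPt (t : Idx) : ptLength t.toPt = t.N := by
  obtain ⟨N, x, y, hx, hy⟩ := t
  simp [ptLength, Idx.toPt, -Nat.cast_natAbs]
  omega

/-- The basis vector at a lattice point, zero when the point corresponds to no label. -/
def ptVec (p : Pt) : H := if IsLabel p then e (ptIdx p) else 0

theorem ptVec_toPt (t : Idx) : ptVec t.toPt = e t := by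
  rw [ptVec, if_pos (isLabel_toPt t), ptIdx_toPt]

theorem ptVec_of_not {p : Pt} (hp : ¬IsLabel p) : ptVec p = 0 := if_neg hp

theorem inner_ptVec (p q : Pt) : ⟪ptVec p, ptVec q⟫_ℂ = if IsLabel p ∧ p = q then 1 else 0 := by
  by_cases hp : IsLabel p
  · by_cases hq : IsLabel q
    · rw [ptVec, ptVec, if_pos hp, if_pos hq, inner_e, e_apply]
      have : ptIdx p = ptIdx q ↔ p = q := by
        refine ⟨fun h => ?_, fun h => by rw [h]⟩
        rw [← toPt_ptIdx hp, h, toPt_ptIdx hq]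
      simp only [this, hp, true_and]
    · rw [ptVec_of_not hq, inner_zero_right, if_neg]
      rintro ⟨h1, rfl⟩
      exact hq h1
  · rw [ptVec_of_not hp, inner_zero_left, if_neg fun h => hp h.1]

theorem hasSum_ptVec (ξ : H) : HasSum (fun p => ⟪ptVec p, ξ⟫_ℂ • ptVec p) ξ := by
  refine (toPt_injective.hasSum_iff fun p hp => ?_).1 ?_
  · have : ¬IsLabel p := fun h => hp ⟨_, toPt_ptIdx h⟩
    rw [ptVec_of_not this, smul_zero]
  · convert hasSum_e ξ using 2 with t
    simp only [Function.comp, ptVec_toPt, inner_e]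

/-- The matrix of an operator, extended by zero to the lattice. -/
def opKernel (T : H →L[ℂ] H) (z : Pt × Pt) : ℂ := ⟪ptVec z.1, T (ptVec z.2)⟫_ℂ

theorem opKernel_toPt (T : H →L[ℂ] H) (i j : Idx) : opKernel T (i.toPt, j.toPt) = T (e j) i := by
  rw [opKernel, ptVec_toPt, ptVec_toPt, inner_e]

theorem opKernel_of_not {T : H →L[ℂ] H} {z : Pt × Pt} (h : ¬(IsLabel z.1 ∧ IsLabel z.2)) :
    opKernel T z = 0 := by
  rw [opKernel]
  by_cases h1 : IsLabel z.1
  · rw [ptVec_of_not fun h2 => h ⟨h1, h2⟩, map_zero, inner_zero_right]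
  · rw [ptVec_of_not h1, inner_zero_left]

/-- Relations between matrices carry over to kernels. -/
theorem opKernel_eq {T : H →L[ℂ] H} {K : Pt × Pt → ℂ}
    (hK : ∀ z, ¬(IsLabel z.1 ∧ IsLabel z.2) → K z = 0)
    (h : ∀ i j : Idx, T (e j) i = K (i.toPt, j.toPt)) : opKernel T = K := by
  ext z
  by_cases hz : IsLabel z.1 ∧ IsLabel z.2
  · have := h (ptIdx z.1) (ptIdx z.2)
    rwa [← opKernel_toPt, toPt_ptIdx hz.1, toPt_ptIdx hz.2] at this
  · rw [opKernel_of_not hz, hK z hz]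

theorem opKernel_mul (S T : H →L[ℂ] H) :
    opKernel (S * T) = convKer (opKernel S) (opKernel T) := by
  ext z
  have h := (((hasSum_ptVec (T (ptVec z.2))).mapL S).mapL (innerSL ℂ (ptVec z.1))).tsum_eq
  rw [convKer, opKernel]
  simp only [map_smul, innerSL_apply_apply, smul_eq_mul] at h
  refine h.symm.trans ?_
  exact tsum_congr fun s => mul_comm _ _

theorem opKernel_add (S T : H →L[ℂ] H) : opKernel (S + T) = opKernel S + opKernel T := by
  ext z
  simp [opKernel]

theorem opKernel_smul (c : ℂ) (T : H →L[ℂ] H) : opKernel (c • T) = c • opKernel T := by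
  ext z
  simp [opKernel]

theorem opKernel_one (z : Pt × Pt) :
    opKernel 1 z = if IsLabel z.1 ∧ z.1 = z.2 then 1 else 0 := by
  exact inner_ptVec z.1 z.2

/-- The operator with matrix supported on the `v`-th diagonal. -/
theorem exists_diagonal (K : Pt × Pt → ℂ) (v : Pt) (C : ℝ) (hC0 : 0 ≤ C)
    (hC : ∀ p, ‖K (p, p - v)‖ ≤ C) : ∃ T : H →L[ℂ] H, ‖T‖ ≤ C ∧
      ∀ i j : Idx, T (e j) i = if i.toPt - v = j.toPt then K (i.toPt, j.toPt) else 0 := by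
  classical
  have hc : ∀ i : Idx,
      ‖(if IsLabel (i.toPt - v) then K (i.toPt, i.toPt - v) else 0)‖ ≤ C := by
    intro i
    split_ifs
    · exact hC _
    · simpa using hC0
  have hφ : Set.InjOn (fun i : Idx => ptIdx (i.toPt - v)) (Function.support
      fun i : Idx => if IsLabel (i.toPt - v) then K (i.toPt, i.toPt - v) else 0) := by
    intro i hi j hj hij
    have hi' : IsLabel (i.toPt - v) := by
      by_contra h; exact hi (by simp [h])
    have hj' : IsLabel (j.toPt - v) := by
      by_contra h; exact hj (by simp [h])
    have := congrArg Idx.toPt hij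
    simp only [toPt_ptIdx hi', toPt_ptIdx hj', sub_left_inj] at this
    exact toPt_injective this
  refine ⟨weightedPull _ _ C hc hφ, ?_, fun i j => ?_⟩
  · refine (LinearMap.mkContinuous_norm_le _ (abs_nonneg C) _).trans (abs_of_nonneg hC0).le
  · rw [weightedPull_apply, e_apply]
    by_cases h : i.toPt - v = j.toPt
    · simp only [h, ptIdx_toPt, if_pos, isLabel_toPt, mul_one]
    · rw [if_neg h]
      split_ifs with h1 h2 h2
      · exact absurd (by rw [← h2, toPt_ptIdx h1]) h
      all_goals simp

/-- A kernel of rapid decay off the diagonal is the matrix of a bounded operator. -/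
theorem exists_op_of_rapid {K : Pt × Pt → ℂ} (hK : Rapid offDiag K) :
    ∃ T : H →L[ℂ] H, ∀ i j : Idx, T (e j) i = K (i.toPt, j.toPt) := by
  classical
  obtain ⟨C, hC0, hC⟩ := hK.exists_bound 6
  have h1 : ∀ v : Pt, ∃ T : H →L[ℂ] H, ‖T‖ ≤ C * ((1 + (offDiag (v, 0) : ℝ)) ^ 6)⁻¹ ∧
      ∀ i j : Idx, T (e j) i = if i.toPt - v = j.toPt then K (i.toPt, j.toPt) else 0 := by
    intro v
    refine exists_diagonal K v _ (by positivity) fun p => ?_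
    have := hC (p, p - v)
    simpa [offDiag] using this
  choose T hT hT' using h1
  -- The operator is the norm-convergent sum of its diagonals, indexed by the displacement v; each
  -- has norm at most the supremum of its entries.
  have hs : Summable T := Summable.of_norm_bounded (summable_decay.mul_left C) hT
  refine ⟨∑' v, T v, fun i j => ?_⟩
  have h2 := ((hs.hasSum.mapL (ContinuousLinearMap.apply ℂ H (e j))).mapL
    (lp.evalCLM ℂ (fun _ : Idx => ℂ) (p := 2) i))
  have h3 : HasSum (fun v => T v (e j) i) ((∑' v, T v) (e j) i) := h2
  refine h3.unique ?_
  simp only [hT']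
  convert hasSum_ite_eq (i.toPt - j.toPt) (K (i.toPt, j.toPt)) using 3 with v
  constructor
  · intro h; rw [← h]; abel
  · intro h; rw [h]; abel

/-! ### Smooth operators -/

/-- Operators with smooth kernel. -/
def SmoothOp (T : H →L[ℂ] H) : Prop := SmoothKernel (opKernel T)

theorem SmoothOp.add {S T : H →L[ℂ] H} (hS : SmoothOp S) (hT : SmoothOp T) : SmoothOp (S + T) := by
  rw [SmoothOp, opKernel_add]; exact SmoothKernel.add hS hT

theorem SmoothOp.smul {T : H →L[ℂ] H} (hT : SmoothOp T) (c : ℂ) : SmoothOp (c • T) := by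
  rw [SmoothOp, opKernel_smul]; exact SmoothKernel.smul hT c

theorem SmoothOp.mul {S T : H →L[ℂ] H} (hS : SmoothOp S) (hT : SmoothOp T) : SmoothOp (S * T) := by
  rw [SmoothOp, opKernel_mul]; exact SmoothKernel.conv hS hT

theorem smoothOp_one : SmoothOp 1 where
  rapid r := ⟨1, fun z => by
    rw [opKernel_one]
    split_ifs with h
    · simp [offDiag, h.2]
    · simp⟩
  diff i := by
    -- The extended identity is the indicator function of the diagonal over labels, so it changes
    -- only at the walls k = 0 and c = 0.
    have h1 : ∀ z : Pt × Pt, shiftDiff i (opKernel 1) z ≠ 0 → z.1 = z.2 ∧ (z.1 i).natAbs ≤ 1 := by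
      intro z hz
      simp only [shiftDiff, shift, opKernel_one, add_left_inj] at hz
      by_cases h : z.1 = z.2
      · refine ⟨h, ?_⟩
        by_contra hc
        have hl : IsLabel (z.1 + Pi.single i 1) ↔ IsLabel z.1 := by
          revert hc
          fin_cases i <;> simp [IsLabel] <;> omega
        simp [hl] at hz
      · simp [h] at hz
    intro r
    refine ⟨2 ^ r * 2, fun z => ?_⟩
    by_cases hz : shiftDiff i (opKernel 1) z = 0
    · rw [hz]; simp
    · obtain ⟨h2, h3⟩ := h1 z hz
      have h4 : (dirWeight i z : ℝ) ≤ 1 := by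
        have : dirWeight i z ≤ 1 := by simpa [dirWeight, offDiag, h2] using h3
        exact_mod_cast this
      have h5 : ‖shiftDiff i (opKernel 1) z‖ ≤ 2 := by
        simp only [shiftDiff, opKernel_one]
        refine (norm_sub_le _ _).trans ?_
        split_ifs <;> norm_num
      gcongr
      linarith

/-! ### Commutators with |D| and powers of δ -/

theorem abs_diracEig (t : Idx) : |diracEig t| = t.N := by
  unfold diracEig; split_ifs <;> simp

theorem isCommutator_absDirac {T S : H →L[ℂ] H} :
    IsCommutator absDirac T S ↔
      opKernel S = fun z => ((ptLength z.1 - ptLength z.2 : ℤ) : ℂ) * opKernel T z := by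
  rw [absDirac, isCommutator_diagOp]
  constructor
  · intro h
    refine opKernel_eq (fun z hz => by rw [opKernel_of_not hz, mul_zero]) fun i j => ?_
    rw [h, abs_diracEig, abs_diracEig, opKernel_toPt, ptLength_toPt, ptLength_toPt]
    push_cast; ring
  · intro h i j
    rw [← opKernel_toPt, h, abs_diracEig, abs_diracEig]
    simp only [opKernel_toPt, ptLength_toPt]
    push_cast; ring

theorem SmoothOp.isCommutator {T S : H →L[ℂ] H} (hT : SmoothOp T) (h : IsCommutator absDirac T S) :
    SmoothOp S := by
  rw [SmoothOp, isCommutator_absDirac.1 h]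
  exact SmoothKernel.mul_ptLength hT

theorem SmoothOp.exists_isCommutator {T : H →L[ℂ] H} (hT : SmoothOp T) :
    ∃ S, IsCommutator absDirac T S := by
  obtain ⟨S, hS⟩ := exists_op_of_rapid (SmoothKernel.mul_ptLength hT).rapid
  exact ⟨S, isCommutator_absDirac.2
    (opKernel_eq (fun z hz => by rw [opKernel_of_not hz, mul_zero]) hS)⟩

theorem SmoothOp.isDelta {T : H →L[ℂ] H} (hT : SmoothOp T) :
    ∀ {k : ℕ} {S : H →L[ℂ] H}, IsDelta k T S → SmoothOp S
  | 0, _, h => by rw [show _ = T from h]; exact hT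
  | _ + 1, _, ⟨_, h1, h2⟩ => (hT.isDelta h1).isCommutator h2

theorem SmoothOp.exists_isDelta {T : H →L[ℂ] H} (hT : SmoothOp T) : ∀ k, ∃ S, IsDelta k T S
  | 0 => ⟨T, rfl⟩
  | k + 1 => by
    obtain ⟨R, hR⟩ := hT.exists_isDelta k
    obtain ⟨S, hS⟩ := (hT.isDelta hR).exists_isCommutator
    exact ⟨S, R, hR, hS⟩

/-! ### Fourier coefficients of smooth functions -/

theorem IsSmoothCircle.deriv {f : ℝ → ℂ} (hf : IsSmoothCircle f) : IsSmoothCircle (deriv f) := by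
  refine ⟨fun x => ?_, ((contDiff_infty_iff_deriv (𝕜 := ℝ)).1 hf.2).2⟩
  have : (fun y => f (y + 2 * Real.pi)) = f := funext hf.1
  rw [← deriv_comp_add_const, this]

theorem norm_fourierCoeffOn_le {f : ℝ → ℂ} {C : ℝ} (hC : ∀ θ, ‖f θ‖ ≤ C) (n : ℤ) :
    ‖fourierCoeffOn Real.two_pi_pos f n‖ ≤ C := by
  rw [fourierCoeffOn_eq_integral, norm_smul]
  have h := intervalIntegral.norm_integral_le_of_norm_le_const (a := 0) (b := 2 * Real.pi)
    (f := fun x : ℝ => fourier (-n) (x : AddCircle (2 * Real.pi - 0)) • f x) (C := C) fun x _ => by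
      rw [norm_smul, fourier_apply, Circle.norm_coe, one_mul]
      exact hC x
  rw [sub_zero, abs_of_pos Real.two_pi_pos] at h
  rw [sub_zero, Real.norm_of_nonneg (by positivity)]
  calc _ ≤ 1 / (2 * Real.pi) * (C * (2 * Real.pi)) := by
        refine mul_le_mul_of_nonneg_left ?_ (by positivity)
        exact h
    _ = C := by field_simp

theorem fourierCoeffOn_deriv {f : ℝ → ℂ} (hf : IsSmoothCircle f) (n : ℤ) :
    fourierCoeffOn Real.two_pi_pos (deriv f) n
      = Complex.I * n * fourierCoeffOn Real.two_pi_pos f n := by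
  have hd : Differentiable ℝ f := hf.2.differentiable (by simp)
  have hcont : Continuous (deriv f) := hf.deriv.2.continuous
  have hper : f (2 * Real.pi) - f 0 = 0 := by
    have := hf.1 0
    rw [zero_add] at this
    rw [this, sub_self]
  -- Integration by parts divides by n; at n = 0 the integral of the derivative over a period
  -- vanishes.
  by_cases hn : n = 0
  · subst hn
    rw [fourierCoeffOn_eq_integral]
    have : ∫ x in (0 : ℝ)..2 * Real.pi, deriv f x = 0 := by
      rw [intervalIntegral.integral_deriv_eq_sub (fun x _ => hd x) (hcont.intervalIntegrable _ _),
        hper]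
    simp [this]
  · have h := fourierCoeffOn_of_hasDerivAt Real.two_pi_pos hn
      (fun x _ => (hd x).hasDerivAt) (hcont.intervalIntegrable _ _)
    rw [h, hper]
    have h1 : (n : ℂ) ≠ 0 := by exact_mod_cast hn
    have h2 : (Real.pi : ℂ) ≠ 0 := by exact_mod_cast Real.pi_ne_zero
    push_cast
    field_simp
    ring

theorem norm_pow_mul_fourierCoeffOn_le {f : ℝ → ℂ} (hf : IsSmoothCircle f) (j : ℕ) {C : ℝ}
    (hC : ∀ θ, ‖iteratedDeriv j f θ‖ ≤ C) (n : ℤ) :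
    (n.natAbs : ℝ) ^ j * ‖fourierCoeffOn Real.two_pi_pos f n‖ ≤ C := by
  induction j generalizing f with
  | zero => simpa using norm_fourierCoeffOn_le (by simpa using hC) n
  | succ j ih =>
    have := ih hf.deriv (by simpa only [iteratedDeriv_succ'] using hC)
    rw [fourierCoeffOn_deriv hf, norm_mul, norm_mul, Complex.norm_I, one_mul,
      norm_intCast_eq_natAbs] at this
    rwa [pow_succ, mul_assoc]

/-- The Fourier coefficients of a double sequence of functions. -/
def fourierFamily (f : ℕ → ℕ → ℝ → ℂ) (x : ℕ × ℕ × ℤ) : ℂ :=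
  fourierCoeffOn Real.two_pi_pos (f x.1 x.2.1) x.2.2

theorem RapidDecaySmooth.rapid {f : ℕ → ℕ → ℝ → ℂ} (hf : RapidDecaySmooth f) :
    Rapid (fun x : ℕ × ℕ × ℤ => x.1 + x.2.1 + x.2.2.natAbs) (fourierFamily f) := by
  -- Decay in (k, l) comes from the sup norms and decay in n from the derivatives; the two combine
  -- into joint decay.
  refine Rapid.add_weight (w := fun x : ℕ × ℕ × ℤ => x.1 + x.2.1)
    (w' := fun x : ℕ × ℕ × ℤ => x.2.2.natAbs) (fun r => ?_) fun r => ?_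
  · obtain ⟨C, hC⟩ := hf.2 r 0
    refine ⟨C, fun ⟨k, l, n⟩ => ?_⟩
    have h0 : (0 : ℝ) < (1 + (k : ℝ) + l) ^ r := by positivity
    have h1 : ‖fourierCoeffOn Real.two_pi_pos (f k l) n‖ ≤ C / (1 + (k : ℝ) + l) ^ r := by
      refine norm_fourierCoeffOn_le (fun θ => ?_) n
      rw [le_div_iff₀ h0, mul_comm]
      simpa using hC k l θ
    rw [le_div_iff₀ h0, mul_comm, add_assoc] at h1
    simpa [fourierFamily] using h1
  · obtain ⟨C, hC⟩ := hf.2 0 0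
    obtain ⟨C', hC'⟩ := hf.2 0 r
    refine ⟨2 ^ (r - 1) * (C + C'), fun ⟨k, l, n⟩ => ?_⟩
    have h1 := norm_pow_mul_fourierCoeffOn_le (hf.1 k l) 0 (C := C)
      (fun θ => by simpa using hC k l θ) n
    have h2 := norm_pow_mul_fourierCoeffOn_le (hf.1 k l) r (C := C')
      (fun θ => by simpa using hC' k l θ) n
    rw [pow_zero, one_mul] at h1
    calc _ ≤ 2 ^ (r - 1) * (1 ^ r + (n.natAbs : ℝ) ^ r)
          * ‖fourierCoeffOn Real.two_pi_pos (f k l) n‖ := by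
          refine mul_le_mul_of_nonneg_right ?_ (norm_nonneg _)
          exact add_pow_le zero_le_one (by positivity) r
      _ = 2 ^ (r - 1) * (‖fourierCoeffOn Real.two_pi_pos (f k l) n‖ + (n.natAbs : ℝ) ^ r
          * ‖fourierCoeffOn Real.two_pi_pos (f k l) n‖) := by rw [one_pow]; ring
      _ ≤ _ := by gcongr

/-! ### The kernels of the generators -/

theorem pt_ext_iff {p q : Pt} : p = q ↔ p 0 = q 0 ∧ p 1 = q 1 ∧ p 2 = q 2 := by
  refine ⟨fun h => by simp [h], fun h => ?_⟩
  funext i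
  fin_cases i
  exacts [h.1, h.2.1, h.2.2]

theorem hasSum_opKernel {ι : Type*} {T : ι → H →L[ℂ] H} (hT : Summable T) (z : Pt × Pt) :
    HasSum (fun i => opKernel (T i) z) (opKernel (∑' i, T i) z) :=
  ((hT.hasSum.mapL (ContinuousLinearMap.apply ℂ H (ptVec z.2))).mapL (innerSL ℂ (ptVec z.1)))

theorem norm_weightedPull_le (c : Idx → ℂ) (φ : Idx → Idx) (C : ℝ) (hc : ∀ i, ‖c i‖ ≤ C)
    (hφ : Set.InjOn φ (Function.support c)) : ‖weightedPull c φ C hc hφ‖ ≤ |C| :=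
  LinearMap.mkContinuous_norm_le _ (abs_nonneg _) _

theorem norm_alpha_le : ‖alpha‖ ≤ 1 := (norm_weightedPull_le _ _ _ _ _).trans abs_one.le

theorem norm_beta_le : ‖beta‖ ≤ 1 := (norm_weightedPull_le _ _ _ _ _).trans abs_one.le

theorem norm_star_op (T : H →L[ℂ] H) : ‖star T‖ = ‖T‖ := by
  rw [ContinuousLinearMap.star_eq_adjoint]
  exact LinearIsometryEquiv.norm_map _ _

theorem norm_pow_le_one {T : H →L[ℂ] H} (hT : ‖T‖ ≤ 1) (n : ℕ) : ‖T ^ n‖ ≤ 1 := by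
  induction n with
  | zero => rw [pow_zero]; exact ContinuousLinearMap.norm_id_le
  | succ n ih =>
    rw [pow_succ]
    exact (norm_mul_le _ _).trans (mul_le_one₀ ih (norm_nonneg _) hT)

theorem norm_betaPow_le (m : ℤ) : ‖betaPow m‖ ≤ 1 := by
  have h : ‖star beta‖ ≤ 1 := by rw [norm_star_op]; exact norm_beta_le
  unfold betaPow
  split_ifs
  · exact (norm_mul_le _ _).trans (mul_le_one₀ h (norm_nonneg _) norm_beta_le)
  · exact norm_pow_le_one norm_beta_le _
  · exact norm_pow_le_one h _

theorem inner_star_left (T : H →L[ℂ] H) (ξ η : H) : ⟪ξ, star T η⟫_ℂ = ⟪T ξ, η⟫_ℂ := by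
  rw [ContinuousLinearMap.star_eq_adjoint, ContinuousLinearMap.adjoint_inner_right]

/-- With `ptVec` zero off the labels, α is a plain translation: the vanishing of α on the face k = 0
needs no separate case. -/
theorem alpha_ptVec (p : Pt) : alpha (ptVec p) = ptVec (p - Pi.single 0 1) := by
  by_cases hp : IsLabel p
  · by_cases hp' : IsLabel (p - Pi.single 0 1)
    · rw [ptVec, ptVec, if_pos hp, if_pos hp', alpha_e]
      simp only [IsLabel, Pi.sub_apply] at hp hp'
      simp at hp'
      rw [if_pos]
      · congr 1
        simp [ptIdx]
        omega
      · simp [ptIdx]; omega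
    · rw [ptVec, ptVec_of_not hp', if_pos hp, alpha_e, if_neg]
      simp only [IsLabel, Pi.sub_apply] at hp hp'
      simp at hp'
      simp [ptIdx]; omega
  · rw [ptVec_of_not hp, map_zero, ptVec_of_not]
    simp only [IsLabel, Pi.sub_apply] at hp ⊢
    simp
    omega

theorem alpha_pow_ptVec (l : ℕ) (p : Pt) :
    (alpha ^ l) (ptVec p) = ptVec (p - Pi.single 0 (l : ℤ)) := by
  induction l generalizing p with
  | zero => simp
  | succ l ih =>
    rw [pow_succ]
    show (alpha ^ l) (alpha (ptVec p)) = _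
    rw [alpha_ptVec, ih, sub_sub, ← Pi.single_add, add_comm (1 : ℤ)]
    push_cast
    rfl

theorem opKernel_alpha (B : H →L[ℂ] H) (k l : ℕ) (z : Pt × Pt) :
    opKernel (star alpha ^ k * B * alpha ^ l) z
      = opKernel B (z.1 - Pi.single 0 (k : ℤ), z.2 - Pi.single 0 (l : ℤ)) := by
  rw [opKernel, opKernel, ← alpha_pow_ptVec, ← alpha_pow_ptVec, ← star_pow]
  exact inner_star_left _ _ _

/-- The sign by which the action of `β` differs from a shift. -/
def shiftSign (m : ℤ) : ℤ := if 0 ≤ m then (-1) ^ m.toNat else 1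

theorem shiftSign_mul_self (m : ℤ) : shiftSign m * shiftSign m = 1 := by
  unfold shiftSign
  split_ifs
  · rw [← mul_pow]; simp
  · simp

/-- This is the sign of β at m: on the face k = 0, m ≥ 0 means y = 0, where β carries a minus sign.
Being a quotient of consecutive values, the sign telescopes in powers of β. -/
theorem shiftSign_add_one (m : ℤ) :
    shiftSign m * shiftSign (m + 1) = if 0 ≤ m then -1 else 1 := by
  by_cases hm : 0 ≤ m
  · have := shiftSign_mul_self m
    rw [if_pos hm]
    simp only [shiftSign, if_pos hm, if_pos (show 0 ≤ m + 1 by omega)] at this ⊢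
    rw [show (m + 1).toNat = m.toNat + 1 by omega, pow_succ, ← mul_assoc, this]
    simp
  · rw [if_neg hm]
    by_cases h1 : m = -1
    · simp [shiftSign, h1]
    · simp [shiftSign, hm, show ¬0 ≤ m + 1 by omega]

theorem beta_ptVec (p : Pt) : beta (ptVec p) = if p 0 = 0 then
    ((shiftSign (p 1) * shiftSign (p 1 + 1) : ℤ) : ℂ) • ptVec (p + Pi.single 1 1) else 0 := by
  by_cases hp : IsLabel p
  · have hp' : IsLabel (p + Pi.single 1 1) := by simpa [IsLabel] using hp
    rw [ptVec, ptVec, if_pos hp, if_pos hp', beta_e, shiftSign_add_one]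
    obtain ⟨h0, h2⟩ := hp
    by_cases hz : p 0 = 0
    · rw [if_pos hz]
      by_cases h1 : 0 ≤ p 1
      · rw [if_pos h1, if_pos (by simp [ptIdx, hz, h1])]
        simp only [Int.cast_neg, Int.cast_one, neg_smul, one_smul]
        congr 2
        simp [ptIdx, hz]
        omega
      · rw [if_neg h1, if_neg (by simp [ptIdx, hz]; omega), if_pos (by simp [ptIdx, hz]; omega)]
        simp only [Int.cast_one, one_smul]
        congr 1
        simp [ptIdx, hz]
        omega
    · rw [if_neg hz, if_neg (by simp [ptIdx]; omega), if_neg (by simp [ptIdx]; omega)]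
  · have hp' : ¬IsLabel (p + Pi.single 1 1) := by simpa [IsLabel] using hp
    rw [ptVec_of_not hp, ptVec_of_not hp', map_zero, smul_zero, ite_self]

/-- The zeroth power is excluded because the identity does not vanish off the face k = 0; this is
also why the term m = 0 of f(β) uses β*β. -/
theorem beta_pow_ptVec (n : ℕ) (hn : n ≠ 0) (p : Pt) : (beta ^ n) (ptVec p) = if p 0 = 0 then
    ((shiftSign (p 1) * shiftSign (p 1 + n) : ℤ) : ℂ) • ptVec (p + Pi.single 1 (n : ℤ)) else 0 := by
  by_cases hp : p 0 = 0
  · rw [if_pos hp]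
    clear hn
    induction n with
    | zero => simp [shiftSign_mul_self]
    | succ n ih =>
      rw [pow_succ']
      show beta ((beta ^ n) (ptVec p)) = _
      rw [ih, map_smul, beta_ptVec, if_pos (by simpa using hp), smul_smul, add_assoc,
        ← Pi.single_add]
      have e : (p + Pi.single 1 (n : ℤ) : Pt) 1 = p 1 + n := by simp
      rw [e]
      congr 1
      rw [← Int.cast_mul]
      congr 1
      have := shiftSign_mul_self (p 1 + n)
      push_cast
      rw [← add_assoc]
      linear_combination shiftSign (p 1) * shiftSign (p 1 + n + 1) * this
  · rw [if_neg hp]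
    obtain ⟨n, rfl⟩ := Nat.exists_eq_succ_of_ne_zero hn
    rw [Nat.succ_eq_add_one, pow_succ]
    show (beta ^ n) (beta (ptVec p)) = _
    rw [beta_ptVec, if_neg hp, map_zero]

theorem opKernel_betaPow (n : ℤ) (z : Pt × Pt) : opKernel (betaPow n) z =
    if IsLabel z.1 ∧ z.1 0 = 0 ∧ z.2 0 = 0 ∧ z.1 2 = z.2 2 ∧ z.1 1 - z.2 1 = n then
      ((shiftSign (z.1 1) * shiftSign (z.2 1) : ℤ) : ℂ) else 0 := by
  obtain ⟨p, q⟩ := z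
  simp only [opKernel]
  rcases lt_trichotomy n 0 with hn | hn | hn
  · rw [betaPow, if_neg (by omega), if_neg (by omega), ← star_pow, inner_star_left,
      beta_pow_ptVec _ (by omega)]
    by_cases hp : p 0 = 0
    · rw [if_pos hp, inner_smul_left, inner_ptVec, map_intCast, mul_ite, mul_one, mul_zero]
      simp only [pt_ext_iff]
      refine ite_congr (propext ?_) (fun h => ?_) fun _ => rfl
      · simp [IsLabel]; omega
      · rw [show p 1 + ((-n).toNat : ℤ) = q 1 by omega]
    · rw [if_neg hp, inner_zero_left, if_neg (by tauto)]
  · subst hn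
    rw [betaPow, if_pos rfl]
    show ⟪ptVec p, star beta (beta (ptVec q))⟫_ℂ = _
    rw [inner_star_left, beta_ptVec, beta_ptVec]
    by_cases hp : p 0 = 0
    · by_cases hq : q 0 = 0
      · rw [if_pos hp, if_pos hq, inner_smul_left, inner_smul_right, inner_ptVec,
          map_intCast, mul_ite, mul_ite, mul_one, mul_zero, mul_zero]
        simp only [pt_ext_iff]
        refine ite_congr (propext ?_) (fun h => ?_) fun _ => rfl
        · simp [IsLabel]; omega
        · rw [show q 1 = p 1 by omega, ← Int.cast_mul]
          congr 1
          have := shiftSign_mul_self (p 1)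
          have := shiftSign_mul_self (p 1 + 1)
          grind
      · rw [if_neg hq, inner_zero_right, if_neg (by tauto)]
    · rw [if_neg hp, inner_zero_left, if_neg (by tauto)]
  · rw [betaPow, if_neg (by omega), if_pos hn, beta_pow_ptVec _ (by omega)]
    by_cases hq : q 0 = 0
    · rw [if_pos hq, inner_smul_right, inner_ptVec, mul_ite, mul_one, mul_zero]
      simp only [pt_ext_iff]
      refine ite_congr (propext ?_) (fun h => ?_) fun _ => rfl
      · simp [IsLabel]; omega
      · rw [show q 1 + (n.toNat : ℤ) = p 1 by omega, mul_comm]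
    · rw [if_neg hq, inner_zero_right, if_neg (by tauto)]

/-! ### The kernels of the elements of `𝒜` -/

theorem Rapid.summable_nat {f : ℕ → ℂ} (hf : Rapid id f) : Summable fun n => ‖f n‖ := by
  obtain ⟨C, _, hC⟩ := hf.exists_bound 2
  have h := summable_nat_decay
  exact Summable.of_norm_bounded (h.mul_left C) (by simpa using hC)

theorem Rapid.summable_triple {F : ℕ × ℕ × ℤ → ℂ}
    (hF : Rapid (fun x : ℕ × ℕ × ℤ => x.1 + x.2.1 + x.2.2.natAbs) F) :
    Summable fun x : (ℕ × ℕ) × ℤ => ‖F (x.1.1, x.1.2, x.2)‖ := by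
  obtain ⟨C, _, hC⟩ := hF.exists_bound 6
  have h := (summable_decay.mul_left C).comp_injective
    (i := fun x : (ℕ × ℕ) × ℤ => (![(x.1.1 : ℤ), x.1.2, x.2] : Pt)) (by
      rintro ⟨⟨a, b⟩, c⟩ ⟨⟨a', b'⟩, c'⟩ hx
      simpa [and_assoc] using hx)
  refine Summable.of_norm_bounded h fun x => ?_
  rw [norm_norm]
  refine (hC _).trans (le_of_eq ?_)
  simp [offDiag]

theorem summable_funBeta {f : ℝ → ℂ}
    (hf : Summable fun n : ℤ => ‖fourierCoeffOn Real.two_pi_pos f n‖) :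
    Summable fun n : ℤ => fourierCoeffOn Real.two_pi_pos f n • betaPow n := by
  refine Summable.of_norm_bounded hf fun n => ?_
  rw [norm_smul]
  exact mul_le_of_le_one_right (norm_nonneg _) (norm_betaPow_le n)

theorem norm_funBeta_le {f : ℝ → ℂ}
    (hf : Summable fun n : ℤ => ‖fourierCoeffOn Real.two_pi_pos f n‖) :
    ‖funBeta f‖ ≤ ∑' n : ℤ, ‖fourierCoeffOn Real.two_pi_pos f n‖ := by
  refine tsum_of_norm_bounded hf.hasSum fun n => ?_
  rw [norm_smul]
  exact mul_le_of_le_one_right (norm_nonneg _) (norm_betaPow_le n)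

theorem opKernel_funBeta {f : ℝ → ℂ}
    (hf : Summable fun n : ℤ => ‖fourierCoeffOn Real.two_pi_pos f n‖) (z : Pt × Pt) :
    opKernel (funBeta f) z =
      if IsLabel z.1 ∧ z.1 0 = 0 ∧ z.2 0 = 0 ∧ z.1 2 = z.2 2 then
        fourierCoeffOn Real.two_pi_pos f (z.1 1 - z.2 1)
          * ((shiftSign (z.1 1) * shiftSign (z.2 1) : ℤ) : ℂ) else 0 := by
  have h := hasSum_opKernel (summable_funBeta hf) z
  refine h.unique ?_
  convert hasSum_ite_eq (z.1 1 - z.2 1) (if IsLabel z.1 ∧ z.1 0 = 0 ∧ z.2 0 = 0 ∧ z.1 2 = z.2 2 then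
        fourierCoeffOn Real.two_pi_pos f (z.1 1 - z.2 1)
          * ((shiftSign (z.1 1) * shiftSign (z.2 1) : ℤ) : ℂ) else 0) using 2 with n
  rw [opKernel_smul, Pi.smul_apply, opKernel_betaPow, smul_eq_mul]
  by_cases hn : n = z.1 1 - z.2 1
  · subst hn
    simp only [and_true, if_true, mul_ite, mul_zero]
  · rw [if_neg hn, if_neg, mul_zero]
    rintro ⟨-, -, -, -, h⟩
    exact hn h.symm

/-- The kernel of `∑ α*ᵏ f_{kl}(β) αˡ`, in terms of the Fourier coefficients of the `f_{kl}`. -/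
def compactKernel (F : ℕ × ℕ × ℤ → ℂ) (z : Pt × Pt) : ℂ :=
  if IsLabel z.1 ∧ IsLabel z.2 ∧ z.1 2 = z.2 2 then
    F ((z.1 0).toNat, (z.2 0).toNat, z.1 1 - z.2 1)
      * ((shiftSign (z.1 1) * shiftSign (z.2 1) : ℤ) : ℂ) else 0

/-- The kernel of `∑ λ_l αˡ`. -/
def upperKernel (l : ℕ → ℂ) (z : Pt × Pt) : ℂ :=
  if IsLabel z.1 ∧ z.1 1 = z.2 1 ∧ z.1 2 = z.2 2 ∧ z.1 0 ≤ z.2 0 then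
    l (z.2 0 - z.1 0).toNat else 0

/-- The kernel of `∑ λ_k α*ᵏ⁺¹`. -/
def lowerKernel (l : ℕ → ℂ) (z : Pt × Pt) : ℂ :=
  if IsLabel z.2 ∧ z.1 1 = z.2 1 ∧ z.1 2 = z.2 2 ∧ z.2 0 < z.1 0 then
    l (z.1 0 - z.2 0 - 1).toNat else 0

theorem opKernel_tsum_alpha {l : ℕ → ℂ} (hl : Rapid id l) :
    opKernel (∑' k, l k • alpha ^ k) = upperKernel l := by
  ext z
  have hs : Summable fun k => l k • alpha ^ k := by
    refine Summable.of_norm_bounded hl.summable_nat fun k => ?_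
    rw [norm_smul]
    exact mul_le_of_le_one_right (norm_nonneg _) (norm_pow_le_one norm_alpha_le k)
  refine (hasSum_opKernel hs z).unique ?_
  convert hasSum_ite_eq (z.2 0 - z.1 0).toNat (upperKernel l z) using 2 with k
  rw [opKernel_smul, Pi.smul_apply, smul_eq_mul, opKernel, alpha_pow_ptVec, inner_ptVec]
  simp only [pt_ext_iff, upperKernel]
  by_cases hk : k = (z.2 0 - z.1 0).toNat
  · subst hk
    rw [if_pos rfl, mul_ite, mul_one, mul_zero]
    refine ite_congr (propext ?_) (fun h => rfl) fun _ => rfl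
    simp [IsLabel]; omega
  · rw [if_neg hk, if_neg, mul_zero]
    simp [IsLabel]; omega

theorem opKernel_tsum_star_alpha {l : ℕ → ℂ} (hl : Rapid id l) :
    opKernel (∑' k, l k • star alpha ^ (k + 1)) = lowerKernel l := by
  ext z
  have hs : Summable fun k => l k • star alpha ^ (k + 1) := by
    refine Summable.of_norm_bounded hl.summable_nat fun k => ?_
    rw [norm_smul]
    exact mul_le_of_le_one_right (norm_nonneg _)
      (norm_pow_le_one ((norm_star_op _).trans_le norm_alpha_le) _)
  refine (hasSum_opKernel hs z).unique ?_
  convert hasSum_ite_eq (z.1 0 - z.2 0 - 1).toNat (lowerKernel l z) using 2 with k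
  rw [opKernel_smul, Pi.smul_apply, smul_eq_mul, opKernel, ← star_pow, inner_star_left,
    alpha_pow_ptVec, inner_ptVec]
  simp only [pt_ext_iff, lowerKernel]
  by_cases hk : k = (z.1 0 - z.2 0 - 1).toNat
  · subst hk
    rw [if_pos rfl, mul_ite, mul_one, mul_zero]
    refine ite_congr (propext ?_) (fun h => rfl) fun _ => rfl
    simp [IsLabel]; omega
  · rw [if_neg hk, if_neg, mul_zero]
    simp [IsLabel]; omega

theorem opKernel_tsum_funBeta {f : ℕ → ℕ → ℝ → ℂ} (hf : RapidDecaySmooth f) :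
    opKernel (∑' p : ℕ × ℕ, star alpha ^ p.1 * funBeta (f p.1 p.2) * alpha ^ p.2)
      = compactKernel (fourierFamily f) := by
  ext z
  have h3 := hf.rapid.summable_triple
  have hf1 : ∀ p : ℕ × ℕ, Summable fun n : ℤ => ‖fourierCoeffOn Real.two_pi_pos (f p.1 p.2) n‖ :=
    fun p => h3.prod_factor p
  have hs : Summable fun p : ℕ × ℕ => star alpha ^ p.1 * funBeta (f p.1 p.2) * alpha ^ p.2 := by
    refine Summable.of_norm_bounded h3.prod fun p => ?_
    refine (norm_mul_le _ _).trans ((mul_le_of_le_one_right (norm_nonneg _)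
      (norm_pow_le_one norm_alpha_le _)).trans ((norm_mul_le _ _).trans
      ((mul_le_of_le_one_left (norm_nonneg _)
      (norm_pow_le_one ((norm_star_op _).trans_le norm_alpha_le) _)).trans ?_)))
    exact norm_funBeta_le (hf1 p)
  refine (hasSum_opKernel hs z).unique ?_
  convert hasSum_ite_eq ((z.1 0).toNat, (z.2 0).toNat) (compactKernel (fourierFamily f) z)
    using 2 with p
  obtain ⟨k, l⟩ := p
  rw [opKernel_alpha, opKernel_funBeta (hf1 (k, l))]
  simp only [compactKernel, Prod.mk.injEq]
  -- The kernel of f(β) lives on k = 0, so each matrix entry meets exactly one term of the double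
  -- series.
  by_cases hk : k = (z.1 0).toNat ∧ l = (z.2 0).toNat
  · rw [if_pos hk]
    refine ite_congr (propext ?_) (fun h => ?_) fun _ => rfl
    · simp [IsLabel]; omega
    · simp [hk.1, hk.2, fourierFamily]
  · rw [if_neg hk, if_neg]
    simp [IsLabel]; omega

/-- The kernels of the elements of `𝒜`. -/
theorem exists_kernel_of_mem_smoothAlg {a : H →L[ℂ] H} (ha : a ∈ smoothAlg) :
    ∃ (F : ℕ × ℕ × ℤ → ℂ) (l l' : ℕ → ℂ),
      Rapid (fun x : ℕ × ℕ × ℤ => x.1 + x.2.1 + x.2.2.natAbs) F ∧ Rapid id l ∧ Rapid id l' ∧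
      opKernel a = compactKernel F + (upperKernel l + lowerKernel l') := by
  obtain ⟨f, l, l', hf, hl, hl', rfl⟩ := ha
  refine ⟨fourierFamily f, l, l', hf.rapid, hl, hl', ?_⟩
  rw [opKernel_add, opKernel_add, opKernel_tsum_funBeta hf, opKernel_tsum_alpha hl,
    opKernel_tsum_star_alpha hl', add_assoc]

theorem norm_shiftSign_mul (m n : ℤ) : ‖((shiftSign m * shiftSign n : ℤ) : ℂ)‖ = 1 := by
  have h : ∀ m, (shiftSign m).natAbs = 1 := fun m => by
    unfold shiftSign; split_ifs <;> simp [Int.natAbs_pow]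
  rw [norm_intCast_eq_natAbs, Int.natAbs_mul, h, h]
  simp

section Kernels

variable {F : ℕ × ℕ × ℤ → ℂ} {l : ℕ → ℂ}

/-- The indices of f_{kl} are the k-coordinates of the two points, so rapid decay of the
coefficients is also decay away from the face k = 0. -/
theorem rapid_compactKernel
    (hF : Rapid (fun x : ℕ × ℕ × ℤ => x.1 + x.2.1 + x.2.2.natAbs) F) :
    Rapid (dirWeight 0) (compactKernel F) := by
  refine (hF.comp fun z : Pt × Pt => ((z.1 0).toNat, (z.2 0).toNat, z.1 1 - z.2 1)).of_le 2 0
    (fun z hz => ?_) fun z => ?_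
  · have h : IsLabel z.1 ∧ IsLabel z.2 ∧ z.1 2 = z.2 2 := by
      by_contra h; exact hz (if_neg h)
    simp only [IsLabel] at h
    simp only [Function.comp, dirWeight, offDiag]
    omega
  · rw [compactKernel, pow_zero, mul_one]
    split_ifs
    · rw [norm_mul, norm_shiftSign_mul, mul_one]
      simp only [Function.comp]
      push_cast
      linarith [norm_nonneg (F ((z.1 0).toNat, (z.2 0).toNat, z.1 1 - z.2 1))]
    · rw [norm_zero]; positivity

theorem rapid_upperKernel (hl : Rapid id l) : Rapid offDiag (upperKernel l) := by
  refine (hl.comp fun z : Pt × Pt => (z.2 0 - z.1 0).toNat).of_le 1 0 (fun z hz => ?_) fun z => ?_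
  · have h : IsLabel z.1 ∧ z.1 1 = z.2 1 ∧ z.1 2 = z.2 2 ∧ z.1 0 ≤ z.2 0 := by
      by_contra h; exact hz (if_neg h)
    simp only [Function.comp, offDiag, id]
    omega
  · rw [upperKernel]
    split_ifs
    · simp
    · rw [norm_zero]; positivity

theorem rapid_lowerKernel (hl : Rapid id l) : Rapid offDiag (lowerKernel l) := by
  refine (hl.comp fun z : Pt × Pt => (z.1 0 - z.2 0 - 1).toNat).of_le 2 0 (fun z hz => ?_)
    fun z => ?_
  · have h : IsLabel z.2 ∧ z.1 1 = z.2 1 ∧ z.1 2 = z.2 2 ∧ z.2 0 < z.1 0 := by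
      by_contra h; exact hz (if_neg h)
    simp only [Function.comp, offDiag, id]
    omega
  · rw [lowerKernel, pow_zero, mul_one]
    split_ifs
    · simp only [Function.comp]
      push_cast
      linarith [norm_nonneg (l (z.1 0 - z.2 0 - 1).toNat)]
    · rw [norm_zero]; positivity

/-- The kernel depends only on the displacement, apart from the label condition. Far from the wall
compared with the displacement, one step changes that condition for neither point. -/
theorem shiftDiff_upperKernel (i : Fin 3) (z : Pt × Pt) (h : offDiag z + 1 < (z.1 i).natAbs) :
    shiftDiff i (upperKernel l) z = 0 := by
  rw [shiftDiff, sub_eq_zero, upperKernel, upperKernel]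
  refine ite_congr (propext ?_) (fun _ => ?_) fun _ => rfl
  · revert h
    fin_cases i <;> simp [IsLabel, shift, offDiag, -Nat.cast_natAbs] <;> omega
  · congr 2
    fin_cases i <;> simp [shift]

theorem shiftDiff_lowerKernel (i : Fin 3) (z : Pt × Pt) (h : offDiag z + 1 < (z.1 i).natAbs) :
    shiftDiff i (lowerKernel l) z = 0 := by
  rw [shiftDiff, sub_eq_zero, lowerKernel, lowerKernel]
  refine ite_congr (propext ?_) (fun _ => ?_) fun _ => rfl
  · revert h
    fin_cases i <;> simp [IsLabel, shift, offDiag, -Nat.cast_natAbs] <;> omega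
  · congr 2
    fin_cases i <;> simp [shift]

theorem smoothKernel_upperKernel (hl : Rapid id l) : SmoothKernel (upperKernel l) where
  rapid := rapid_upperKernel hl
  diff i := (rapid_upperKernel hl).shiftDiff_of_support fun z hz => by
    by_contra h
    exact hz (shiftDiff_upperKernel i z (by omega))

theorem smoothKernel_lowerKernel (hl : Rapid id l) : SmoothKernel (lowerKernel l) where
  rapid := rapid_lowerKernel hl
  diff i := (rapid_lowerKernel hl).shiftDiff_of_support fun z hz => by
    by_contra h
    exact hz (shiftDiff_lowerKernel i z (by omega))

/-- On either side of m = 0 both signs change by the same factor under translation. -/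
theorem shiftSign_mul_shift {m n : ℤ} (h : 0 ≤ m ∧ 0 ≤ n ∨ m < -1 ∧ n < -1) :
    shiftSign (m + 1) * shiftSign (n + 1) = shiftSign m * shiftSign n := by
  have h1 := shiftSign_add_one m
  have h2 := shiftSign_add_one n
  have h3 := shiftSign_mul_self m
  have h4 := shiftSign_mul_self n
  split_ifs at h1 h2 <;> first | omega | grind

/-- Exact invariance holds along m and c only; along k the kernel is not invariant but decays, which
serves as well. -/
theorem shiftDiff_compactKernel {i : Fin 3} (hi : i ≠ 0) (z : Pt × Pt)
    (h : offDiag z + 1 < (z.1 i).natAbs) : shiftDiff i (compactKernel F) z = 0 := by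
  rw [shiftDiff, sub_eq_zero, compactKernel, compactKernel]
  refine ite_congr (propext ?_) (fun _ => ?_) fun _ => rfl
  · revert h hi
    fin_cases i <;> simp [IsLabel, shift, offDiag, -Nat.cast_natAbs] <;> omega
  · revert h hi
    fin_cases i
    · simp
    · intro _ h
      simp only [shift, offDiag] at h ⊢
      simp at h ⊢
      left
      exact_mod_cast shiftSign_mul_shift (by omega)
    · simp [shift]

theorem smoothKernel_compactKernel
    (hF : Rapid (fun x : ℕ × ℕ × ℤ => x.1 + x.2.1 + x.2.2.natAbs) F) :
    SmoothKernel (compactKernel F) := by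
  have h0 := rapid_compactKernel hF
  have h1 : Rapid offDiag (compactKernel F) :=
    h0.of_weight_le 1 fun z _ => by simp only [dirWeight]; omega
  refine ⟨h1, fun i => ?_⟩
  by_cases hi : i = 0
  · subst hi
    refine Rapid.sub ((h0.comp (shift 0)).of_weight_le 2 fun z _ => ?_) h0
    simp only [Function.comp, dirWeight, offDiag_shift]
    simp only [shift]
    simp
    omega
  · refine h1.shiftDiff_of_support fun z hz => ?_
    by_contra h
    exact hz (shiftDiff_compactKernel hi z (by omega))

end Kernels

theorem smoothOp_of_mem_smoothAlg {a : H →L[ℂ] H} (ha : a ∈ smoothAlg) : SmoothOp a := by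
  obtain ⟨F, l, l', hF, hl, hl', h⟩ := exists_kernel_of_mem_smoothAlg ha
  rw [SmoothOp, h]
  exact (smoothKernel_compactKernel hF).add
    ((smoothKernel_upperKernel hl).add (smoothKernel_lowerKernel hl'))

/-! ### Commutators with `D` -/

/-- The indicator function of the points at which `D` is positive. -/
def posIndicator (p : Pt) : ℤ := if p 2 = 0 ∧ 0 ≤ p 1 then 1 else 0

theorem diracEig_eq (t : Idx) :
    diracEig t = ((ptLength t.toPt * (2 * posIndicator t.toPt - 1) : ℤ) : ℝ) := by
  rw [ptLength_toPt, diracEig, posIndicator]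
  obtain ⟨N, x, y, hx, hy⟩ := t
  by_cases h : x = N
  · rw [if_pos h, if_pos]
    · push_cast; ring
    · simp [Idx.toPt, -Nat.cast_max]; omega
  · rw [if_neg h, if_neg]
    · push_cast; ring
    · simp [Idx.toPt, -Nat.cast_max]; omega

/-- The kernel of `[D, a]`, in terms of that of `a`. -/
def diracKernel (K : Pt × Pt → ℂ) (z : Pt × Pt) : ℂ :=
  ((ptLength z.1 * (2 * posIndicator z.1 - 1) - ptLength z.2 * (2 * posIndicator z.2 - 1) : ℤ) : ℂ)
    * K z

theorem isCommutator_dirac {T S : H →L[ℂ] H} :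
    IsCommutator dirac T S ↔ opKernel S = diracKernel (opKernel T) := by
  rw [dirac, isCommutator_diagOp]
  constructor
  · intro h
    refine opKernel_eq (fun z hz => by rw [diracKernel, opKernel_of_not hz, mul_zero])
      fun i j => ?_
    rw [h, diracEig_eq, diracEig_eq, diracKernel, opKernel_toPt]
    push_cast; ring
  · intro h i j
    rw [← opKernel_toPt, h, diracEig_eq, diracEig_eq, diracKernel, opKernel_toPt]
    push_cast; ring

theorem SmoothKernel.mul_posIndicator {K : Pt × Pt → ℂ} (hK : SmoothKernel K) :
    SmoothKernel fun z => (posIndicator z.1 : ℂ) * K z := by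
  refine hK.mul_left (fun p => (posIndicator p : ℂ)) (fun p => ?_) fun i p h => ?_
  · simp only [posIndicator]
    split_ifs <;> simp
  · have h' : posIndicator (p + Pi.single i 1) ≠ posIndicator p := fun h' => h (by rw [h'])
    by_contra hc
    refine h' ?_
    rw [posIndicator, posIndicator]
    refine ite_congr (propext ?_) (fun _ => rfl) fun _ => rfl
    revert hc
    fin_cases i <;> simp <;> omega

/-- This term carries a length not compensated by a difference. The kernel preserves c, so the
indicator can jump only at c = 0 with m-coordinates on opposite sides of 0; both are then at most
the distance to the diagonal, and the length is at most that distance plus k. The decay of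
`compactKernel` in k absorbs it, in all directions at once. -/
theorem smoothKernel_jump {F : ℕ × ℕ × ℤ → ℂ}
    (hF : Rapid (fun x : ℕ × ℕ × ℤ => x.1 + x.2.1 + x.2.2.natAbs) F) :
    SmoothKernel fun z => (((posIndicator z.1 - posIndicator z.2) * ptLength z.2 : ℤ) : ℂ)
      * compactKernel F z := by
  refine SmoothKernel.of_rapid ?_
  have key : ∀ z, (((posIndicator z.1 - posIndicator z.2) * ptLength z.2 : ℤ) : ℂ)
      * compactKernel F z ≠ 0 → (z.1 1).natAbs ≤ offDiag z ∧ z.1 2 = 0 ∧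
        ((posIndicator z.1 - posIndicator z.2) * ptLength z.2).natAbs ≤ dirWeight 0 z := by
    intro z hz
    have h1 : posIndicator z.1 - posIndicator z.2 ≠ 0 := fun h => hz (by simp [h])
    have h : IsLabel z.1 ∧ IsLabel z.2 ∧ z.1 2 = z.2 2 := by
      by_contra h; exact hz (by rw [compactKernel, if_neg h, mul_zero])
    simp only [IsLabel] at h
    simp only [posIndicator] at h1 ⊢
    simp only [dirWeight, offDiag, ptLength]
    split_ifs at h1 ⊢ <;> omega
  refine (rapid_compactKernel hF).of_le 2 1 (fun z hz => ?_) fun z => ?_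
  · obtain ⟨h1, h2, -⟩ := key z hz
    simp only [dirWeight, h2, Int.natAbs_zero]
    omega
  · by_cases hz : (((posIndicator z.1 - posIndicator z.2) * ptLength z.2 : ℤ) : ℂ)
      * compactKernel F z = 0
    · rw [hz, norm_zero]; positivity
    · rw [norm_mul, norm_intCast_eq_natAbs]
      refine mul_le_mul_of_nonneg_right ?_ (norm_nonneg _)
      have h3 : ((((posIndicator z.1 - posIndicator z.2) * ptLength z.2).natAbs : ℕ) : ℝ)
          ≤ dirWeight 0 z := by exact_mod_cast (key z hz).2.2
      push_cast at h3 ⊢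
      linarith [(Nat.cast_nonneg (dirWeight 0 z) : (0 : ℝ) ≤ dirWeight 0 z)]

theorem smoothKernel_diracKernel {a : H →L[ℂ] H} (ha : a ∈ smoothAlg) :
    SmoothKernel (diracKernel (opKernel a)) := by
  have hs : SmoothKernel (opKernel a) := smoothOp_of_mem_smoothAlg ha
  obtain ⟨F, l, l', hF, hl, hl', h⟩ := exists_kernel_of_mem_smoothAlg ha
  -- With ℓ the length: ℓ(p)(2χ(p) - 1) - ℓ(q)(2χ(q) - 1) = (2χ(p) - 1)(ℓ(p) - ℓ(q)) + 2(χ(p) -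
  -- χ(q)) ℓ(q).
  have e : diracKernel (opKernel a) =
      (-1 : ℂ) • (fun z => ((ptLength z.1 - ptLength z.2 : ℤ) : ℂ) * opKernel a z)
      + (2 : ℂ) • (fun z => (posIndicator z.1 : ℂ)
        * (((ptLength z.1 - ptLength z.2 : ℤ) : ℂ) * opKernel a z))
      + (2 : ℂ) • (fun z => (((posIndicator z.1 - posIndicator z.2) * ptLength z.2 : ℤ) : ℂ)
        * compactKernel F z) := by
    ext z
    -- The series in α and α* preserve m and c, hence χ, so they do not contribute to the jump term.
    have h1 : ((posIndicator z.1 - posIndicator z.2 : ℤ) : ℂ) * (upperKernel l + lowerKernel l') z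
        = 0 := by
      by_cases h1 : z.1 1 = z.2 1 ∧ z.1 2 = z.2 2
      · simp [posIndicator, h1.1, h1.2]
      · rw [Pi.add_apply, upperKernel, lowerKernel, if_neg (by tauto), if_neg (by tauto), add_zero,
          mul_zero]
    have h2 := congrFun h z
    rw [Pi.add_apply, Pi.add_apply] at h2
    simp only [diracKernel, Pi.add_apply (f := _), Pi.smul_apply, smul_eq_mul] at h1 ⊢
    push_cast at h1 ⊢
    rw [h2]
    linear_combination (2 * (ptLength z.2 : ℂ)) * h1
  rw [e]
  exact ((hs.mul_ptLength.smul _).add (hs.mul_ptLength.mul_posIndicator.smul _)).add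
    ((smoothKernel_jump hF).smul _)

theorem exists_isCommutator_dirac {a : H →L[ℂ] H} (ha : a ∈ smoothAlg) :
    ∃ da, IsCommutator dirac a da := by
  obtain ⟨S, hS⟩ := exists_op_of_rapid (smoothKernel_diracKernel ha).rapid
  exact ⟨S, isCommutator_dirac.2
    (opKernel_eq (fun z hz => by rw [diracKernel, opKernel_of_not hz, mul_zero]) hS)⟩

theorem smoothOp_of_isCommutator_dirac {a da : H →L[ℂ] H} (ha : a ∈ smoothAlg)
    (h : IsCommutator dirac a da) : SmoothOp da := by
  rw [SmoothOp, isCommutator_dirac.1 h]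
  exact smoothKernel_diracKernel ha

theorem smoothOp_of_mem_algB {b : H →L[ℂ] H} (hb : b ∈ algB) : SmoothOp b := by
  induction hb using Algebra.adjoin_induction with
  | mem x hx =>
    obtain ⟨a, ha, k, h | ⟨da, hda, h⟩⟩ := hx
    · exact (smoothOp_of_mem_smoothAlg ha).isDelta h
    · exact (smoothOp_of_isCommutator_dirac ha hda).isDelta h
  | algebraMap r =>
    rw [Algebra.algebraMap_eq_smul_one]
    exact smoothOp_one.smul r
  | add x y _ _ hx hy => exact hx.add hy
  | mul x y _ _ hx hy => exact hx.mul hy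

/-! ### Traces -/

theorem absDiracNegPow_e {ε : ℝ} (hε : 0 < ε) {s : ℂ} (hs : 0 ≤ s.re) (t : Idx) :
    absDiracNegPow ε s (e t) = ((absDiracEig ε t : ℝ) : ℂ) ^ (-s) • e t := by
  refine H_ext fun i => ?_
  rw [absDiracNegPow_apply hε hs, lp.coeFn_smul, Pi.smul_apply, smul_eq_mul, e_apply]
  split_ifs with h
  · rw [h]
  · simp

theorem absDiracEig_eq (ε : ℝ) (t : Idx) : absDiracEig ε t = if t.N = 0 then ε else t.N := by
  simp [absDiracEig, abs_diracEig]

theorem absDiracEig_pos {ε : ℝ} (hε : 0 < ε) (t : Idx) : 0 < absDiracEig ε t := by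
  rw [absDiracEig_eq]
  split_ifs with h
  · exact hε
  · exact_mod_cast Nat.pos_of_ne_zero h

theorem summable_nat_one_add_rpow {τ : ℝ} (hτ : 1 < τ) :
    Summable fun n : ℕ => (1 + (n : ℝ)) ^ (-τ) := by
  have := (summable_nat_add_iff 1).2 (Real.summable_nat_rpow.2 (by linarith : -τ < -1))
  simpa [add_comm] using this

/-- Since x, y ≤ N, the exponent can be shared equally among N, x and y, giving a product of three
convergent series of exponent σ/3 > 1. -/
theorem summable_idx_rpow {σ : ℝ} (hσ : 3 < σ) :
    Summable fun t : Idx => (1 + (t.N : ℝ)) ^ (-σ) := by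
  have h0 := summable_nat_one_add_rpow (τ := σ / 3) (by linarith)
  have h := (h0.mul_of_nonneg (h0.mul_of_nonneg h0
    (fun _ => by positivity) (fun _ => by positivity))
    (fun _ => by positivity) (fun _ => by positivity)).comp_injective
    (i := fun t : Idx => (t.N, t.x, t.y)) (by
      intro s t hst
      simp only [Prod.mk.injEq] at hst
      exact Idx.ext hst.1 hst.2.1 hst.2.2)
  refine h.of_nonneg_of_le (fun _ => by positivity) fun t => ?_
  have hx : (t.x : ℝ) ≤ t.N := by exact_mod_cast t.hx
  have hy : (t.y : ℝ) ≤ t.N := by exact_mod_cast t.hy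
  have hτ : -(σ / 3) ≤ 0 := by linarith
  calc (1 + (t.N : ℝ)) ^ (-σ)
      = (1 + (t.N : ℝ)) ^ (-(σ / 3)) * ((1 + (t.N : ℝ)) ^ (-(σ / 3))
        * (1 + (t.N : ℝ)) ^ (-(σ / 3))) := by
        rw [← Real.rpow_add (by positivity), ← Real.rpow_add (by positivity)]
        congr 1; ring
    _ ≤ _ := by
        simp only [Function.comp]
        refine mul_le_mul_of_nonneg_left ?_ (by positivity)
        refine mul_le_mul ?_ ?_ (by positivity) (by positivity)
        · exact Real.rpow_le_rpow_of_nonpos (by positivity) (by linarith) hτ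
        · exact Real.rpow_le_rpow_of_nonpos (by positivity) (by linarith) hτ

theorem summable_absDiracEig {ε : ℝ} (hε : 0 < ε) {s : ℂ} (hs : 3 < s.re) :
    Summable fun t : Idx => ‖((absDiracEig ε t : ℝ) : ℂ) ^ (-s)‖ := by
  refine ((summable_idx_rpow hs).mul_left ((2 : ℝ) ^ s.re + ε ^ (-s.re))).of_nonneg_of_le
    (fun _ => norm_nonneg _) fun t => ?_
  rw [Complex.norm_cpow_eq_rpow_re_of_pos (absDiracEig_pos hε t), Complex.neg_re, absDiracEig_eq]
  have h2 : (0 : ℝ) < 2 ^ s.re := by positivity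
  have h3 : 0 < ε ^ (-s.re) := by positivity
  split_ifs with h
  · simp only [h, Nat.cast_zero, add_zero, Real.one_rpow, mul_one]
    linarith
  -- For N ≥ 1, N ≥ (1 + N)/2; this is the source of the factor 2^(Re s).
  · have h1 : (1 : ℝ) ≤ t.N := by exact_mod_cast Nat.one_le_iff_ne_zero.2 h
    have h4 : (t.N : ℝ) ^ (-s.re) ≤ ((1 + (t.N : ℝ)) / 2) ^ (-s.re) :=
      Real.rpow_le_rpow_of_nonpos (by positivity) (by linarith) (by linarith)
    rw [Real.div_rpow (by positivity) (by norm_num), Real.rpow_neg (by norm_num : (0 : ℝ) ≤ 2),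
      div_inv_eq_mul, mul_comm] at h4
    refine h4.trans ?_
    gcongr
    linarith

theorem norm_absOp_apply {E : Type*} [NormedAddCommGroup E] [InnerProductSpace ℂ E]
    [CompleteSpace E] (T : E →L[ℂ] E) (ξ : E) : ‖absOp T ξ‖ = ‖T ξ‖ := by
  have adj : ∀ (S : E →L[ℂ] E) (x y : E), ⟪x, star S y⟫_ℂ = ⟪S x, y⟫_ℂ := fun S x y => by
    rw [ContinuousLinearMap.star_eq_adjoint, ContinuousLinearMap.adjoint_inner_right]
  have hsa : star (CFC.abs T) = CFC.abs T := (CFC.abs_nonneg T).isSelfAdjoint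
  have h : ⟪absOp T ξ, absOp T ξ⟫_ℂ = ⟪T ξ, T ξ⟫_ℂ := by
    calc ⟪absOp T ξ, absOp T ξ⟫_ℂ = ⟪ξ, star (absOp T) (absOp T ξ)⟫_ℂ := (adj _ _ _).symm
      _ = ⟪ξ, (CFC.abs T * CFC.abs T) ξ⟫_ℂ := by rw [absOp, hsa]; rfl
      _ = ⟪ξ, star T (T ξ)⟫_ℂ := by rw [CFC.abs_mul_abs]; rfl
      _ = ⟪T ξ, T ξ⟫_ℂ := adj _ _ _
  rw [inner_self_eq_norm_sq_to_K, inner_self_eq_norm_sq_to_K] at h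
  have h' : ‖absOp T ξ‖ ^ 2 = ‖T ξ‖ ^ 2 := by exact_mod_cast h
  exact (sq_eq_sq₀ (norm_nonneg _) (norm_nonneg _)).1 h'

theorem norm_e (t : Idx) : ‖e t‖ = 1 := by
  classical
  rw [e, lp.norm_single (by norm_num)]
  simp

/-- A bounded operator times `|D|^{-s}` is of trace class. -/
theorem isTraceClass_mul_absDiracNegPow (b : H →L[ℂ] H) {ε : ℝ} (hε : 0 < ε) {s : ℂ}
    (hs : 3 < s.re) : IsTraceClass (b * absDiracNegPow ε s) := by
  refine Summable.of_norm_bounded ((summable_absDiracEig hε hs).mul_right ‖b‖) fun t => ?_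
  refine (norm_inner_le_norm _ _).trans ?_
  rw [norm_e, one_mul, norm_absOp_apply]
  show ‖b (absDiracNegPow ε s (e t))‖ ≤ _
  rw [absDiracNegPow_e hε (by linarith), map_smul, norm_smul]
  gcongr
  simpa [norm_e] using b.le_opNorm (e t)

theorem zetaFun_eq (b : H →L[ℂ] H) {ε : ℝ} (hε : 0 < ε) {s : ℂ} (hs : 3 < s.re) :
    HasSum (fun t : Idx => opKernel b (t.toPt, t.toPt) * ((absDiracEig ε t : ℝ) : ℂ) ^ (-s))
      (zetaFun ε b s) := by
  have h : ∀ t : Idx, ⟪e t, (b * absDiracNegPow ε s) (e t)⟫_ℂ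
      = opKernel b (t.toPt, t.toPt) * ((absDiracEig ε t : ℝ) : ℂ) ^ (-s) := by
    intro t
    show ⟪e t, b (absDiracNegPow ε s (e t))⟫_ℂ = _
    rw [absDiracNegPow_e hε (by linarith), map_smul, inner_smul_right, inner_e, opKernel_toPt,
      mul_comm]
  have hs' : Summable fun t : Idx =>
      opKernel b (t.toPt, t.toPt) * ((absDiracEig ε t : ℝ) : ℂ) ^ (-s) := by
    refine Summable.of_norm_bounded ((summable_absDiracEig hε hs).mul_left ‖b‖) fun t => ?_
    rw [norm_mul, opKernel_toPt]
    gcongr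
    refine (lp.norm_apply_le_norm (by norm_num) _ _).trans ?_
    simpa [norm_e] using b.le_opNorm (e t)
  rw [zetaFun, opTrace, tsum_congr h]
  exact hs'.hasSum

/-! ### Summation over the levels of `|D|` -/

/-- The lattice point with coordinates `(k, m, c)`. -/
def mkPt (k m c : ℤ) : Pt := ![k, m, c]

theorem simplex_bijective : Function.Bijective
    (fun x : Σ p : ℕ × ℕ, Finset.HasAntidiagonal.antidiagonal p.2 => (x.1.1, (x.2 : ℕ × ℕ))) := by
  constructor
  · rintro ⟨⟨a, n⟩, ⟨r, hr⟩⟩ ⟨⟨a', n'⟩, ⟨r', hr'⟩⟩ h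
    simp only [Prod.mk.injEq] at h
    obtain ⟨rfl, rfl⟩ := h
    rw [Finset.HasAntidiagonal.mem_antidiagonal] at hr hr'
    simp only at hr hr'
    subst hr hr'
    rfl
  · rintro ⟨a, r⟩
    exact ⟨⟨(a, r.1 + r.2), ⟨r, by simp⟩⟩, rfl⟩

theorem antidiagonal_bijective : Function.Bijective
    (fun x : Σ n : ℕ, Finset.HasAntidiagonal.antidiagonal n => (x.2 : ℕ × ℕ)) := by
  constructor
  · rintro ⟨n, ⟨r, hr⟩⟩ ⟨n', ⟨r', hr'⟩⟩ h
    simp only at h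
    subst h
    rw [Finset.HasAntidiagonal.mem_antidiagonal] at hr hr'
    subst hr hr'
    rfl
  · intro r
    exact ⟨⟨r.1 + r.2, ⟨r, by simp⟩⟩, rfl⟩

/-- Group the triples first by b + c, then by a + (b + c); the weight W is constant on each level.
-/
theorem hasSum_simplexSum {g : ℕ → ℕ → ℕ → ℂ} {W : ℕ → ℂ} {A : ℂ}
    (h : HasSum (fun x : ℕ × ℕ × ℕ => g x.1 x.2.1 x.2.2 * W (x.1 + x.2.1 + x.2.2)) A) :
    HasSum (fun n => simplexSum g n * W n) A := by
  have h1 := ((Equiv.ofBijective _ simplex_bijective).hasSum_iff.2 h).sigma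
    fun p => (Finset.hasSum (Finset.HasAntidiagonal.antidiagonal p.2)
      fun r : ℕ × ℕ => g p.1 r.1 r.2 * W (p.1 + r.1 + r.2))
  have h2 := ((Equiv.ofBijective _ antidiagonal_bijective).hasSum_iff.2 h1).sigma
    fun n => (Finset.hasSum (Finset.HasAntidiagonal.antidiagonal n) fun p : ℕ × ℕ =>
      ∑ r ∈ Finset.HasAntidiagonal.antidiagonal p.2, g p.1 r.1 r.2 * W (p.1 + r.1 + r.2))
  convert h2 using 2 with n
  rw [simplexSum, antiSum, Finset.sum_mul]
  refine Finset.sum_congr rfl fun p hp => ?_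
  rw [antiSum, Finset.sum_mul]
  refine Finset.sum_congr rfl fun r hr => ?_
  rw [Finset.HasAntidiagonal.mem_antidiagonal] at hp hr
  rw [add_assoc, hr, hp]

/-- The labels split into two copies of ℕ³ according to the sign of m. For m = -1 - b the length is
a + b + c + 1, so this half enters level N through the simplex of size N - 1. -/
theorem idx_bijective : Function.Bijective (Sum.elim
    (fun x : ℕ × ℕ × ℕ => ptIdx (mkPt x.1 x.2.1 x.2.2))
    (fun x : ℕ × ℕ × ℕ => ptIdx (mkPt x.1 (-1 - x.2.1) x.2.2))) := by
  have hl : ∀ (a c : ℕ) (m : ℤ), IsLabel (mkPt a m c) := fun a c m => by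
    simp [IsLabel, mkPt]
  constructor
  · rintro (⟨a, b, c⟩ | ⟨a, b, c⟩) (⟨a', b', c'⟩ | ⟨a', b', c'⟩) h
    all_goals
      have h := congrArg Idx.toPt h
      simp only [Sum.elim_inl, Sum.elim_inr, toPt_ptIdx (hl _ _ _), pt_ext_iff] at h
      simp [mkPt] at h
      try simp
      omega
  · intro t
    have h1 := isLabel_toPt t
    by_cases h : 0 ≤ t.toPt 1
    · refine ⟨Sum.inl ((t.toPt 0).toNat, (t.toPt 1).toNat, (t.toPt 2).toNat), ?_⟩
      have : mkPt (t.toPt 0).toNat (t.toPt 1).toNat (t.toPt 2).toNat = t.toPt := by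
        simp only [IsLabel] at h1
        refine pt_ext_iff.2 ?_
        simp [mkPt]
        omega
      simp only [Sum.elim_inl, this, ptIdx_toPt]
    · refine ⟨Sum.inr ((t.toPt 0).toNat, (-1 - t.toPt 1).toNat, (t.toPt 2).toNat), ?_⟩
      have : mkPt (t.toPt 0).toNat (-1 - (-1 - t.toPt 1).toNat) (t.toPt 2).toNat = t.toPt := by
        simp only [IsLabel] at h1
        refine pt_ext_iff.2 ?_
        simp [mkPt]
        omega
      simp only [Sum.elim_inr, this, ptIdx_toPt]

/-- The sum of the diagonal values of a kernel over the labels with given `N`. -/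
def levelSum (K : Pt × Pt → ℂ) (N : ℕ) : ℂ :=
  simplexSum (fun a b c => K (mkPt a b c, mkPt a b c)) N + if N = 0 then 0 else
    simplexSum (fun a b c => K (mkPt a (-1 - b) c, mkPt a (-1 - b) c)) (N - 1)

theorem hasSum_levelSum {K : Pt × Pt → ℂ} {W : ℕ → ℂ} {A : ℂ}
    (hs : HasSum (fun t : Idx => K (t.toPt, t.toPt) * W t.N) A) :
    HasSum (fun n => levelSum K n * W n) A := by
  have hl : ∀ (a c : ℕ) (m : ℤ), IsLabel (mkPt a m c) := fun a c m => by
    simp [IsLabel, mkPt]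
  have h := (Equiv.ofBijective _ idx_bijective).hasSum_iff.2 hs
  have hN : ∀ (a c : ℕ) (m : ℤ), (ptIdx (mkPt a m c)).N = a + m.natAbs + c := fun a c m => by
    simp [ptIdx, mkPt]
  have e1 : ((fun t : Idx => K (t.toPt, t.toPt) * W t.N) ∘ Equiv.ofBijective _ idx_bijective)
      ∘ Sum.inl = fun x : ℕ × ℕ × ℕ => K (mkPt x.1 x.2.1 x.2.2, mkPt x.1 x.2.1 x.2.2)
        * W (x.1 + x.2.1 + x.2.2) := by
    ext x
    simp only [Function.comp, Equiv.ofBijective_apply, Sum.elim_inl, toPt_ptIdx (hl _ _ _), hN,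
      Int.natAbs_natCast]
  have e2 : ((fun t : Idx => K (t.toPt, t.toPt) * W t.N) ∘ Equiv.ofBijective _ idx_bijective)
      ∘ Sum.inr = fun x : ℕ × ℕ × ℕ =>
        K (mkPt x.1 (-1 - x.2.1) x.2.2, mkPt x.1 (-1 - x.2.1) x.2.2)
        * W (x.1 + x.2.1 + x.2.2 + 1) := by
    ext x
    have : x.1 + (-1 - (x.2.1 : ℤ)).natAbs + x.2.2 = x.1 + x.2.1 + x.2.2 + 1 := by omega
    simp only [Function.comp, Equiv.ofBijective_apply, Sum.elim_inr, toPt_ptIdx (hl _ _ _), hN,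
      this]
  have h1 := h.summable.comp_injective Sum.inl_injective
  have h2 := h.summable.comp_injective Sum.inr_injective
  have h3 := HasSum.sum h1.hasSum h2.hasSum
  rw [e1] at h1
  rw [e2] at h2
  rw [e1, e2] at h3
  have h4 := hasSum_simplexSum (g := fun a b c => K (mkPt a b c, mkPt a b c)) h1.hasSum
  have h5 := hasSum_simplexSum (g := fun a b c => K (mkPt a (-1 - b) c, mkPt a (-1 - b) c))
    (W := fun n => W (n + 1)) h2.hasSum
  rw [h.unique h3]
  have h6 : HasSum (fun n => (if n = 0 then 0 else
      simplexSum (fun a b c => K (mkPt a (-1 - b) c, mkPt a (-1 - b) c)) (n - 1)) * W n)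
      (∑' x : ℕ × ℕ × ℕ, K (mkPt x.1 (-1 - x.2.1) x.2.2, mkPt x.1 (-1 - x.2.1) x.2.2)
      * W (x.1 + x.2.1 + x.2.2 + 1)) := by
    rw [← hasSum_nat_add_iff' 1]
    simpa using h5
  convert h4.add h6 using 2 with n
  rw [levelSum, add_mul]

theorem asympPoly_levelSum {K : Pt × Pt → ℂ} (hK : SmoothKernel K) :
    AsympPoly 3 (levelSum K) := by
  refine AsympPoly.add ?_ (asympPoly_comp_succ.1 ?_)
  · have key : ∀ (i : Fin 3) (k : ℕ × ℕ × ℕ → ℕ), (∀ z, k z = (mkPt z.1 z.2.1 z.2.2 i).natAbs) →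
        Rapid k fun z => shiftDiff i K (mkPt z.1 z.2.1 z.2.2, mkPt z.1 z.2.1 z.2.2) := by
      intro i k hk
      exact ((hK.diff i).comp fun z : ℕ × ℕ × ℕ =>
        (mkPt z.1 z.2.1 z.2.2, mkPt z.1 z.2.1 z.2.2)).of_weight_le 1 fun z _ => by
          simp only [Function.comp, dirWeight, hk]; omega
    refine asympPoly_simplexSum ?_ ?_ ?_
    · convert key 0 (fun z => z.1) (fun z => by simp [mkPt]) using 2 with z
      have : mkPt z.1 z.2.1 z.2.2 + Pi.single 0 1 = mkPt (z.1 + 1 : ℕ) z.2.1 z.2.2 := by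
        refine pt_ext_iff.2 ?_
        simp [mkPt]
      simp only [shiftDiff, shift, this]
    · convert key 1 (fun z => z.2.1) (fun z => by simp [mkPt]) using 2 with z
      have : mkPt z.1 z.2.1 z.2.2 + Pi.single 1 1 = mkPt z.1 (z.2.1 + 1 : ℕ) z.2.2 := by
        refine pt_ext_iff.2 ?_
        simp [mkPt]
      simp only [shiftDiff, shift, this]
    · convert key 2 (fun z => z.2.2) (fun z => by simp [mkPt]) using 2 with z
      have : mkPt z.1 z.2.1 z.2.2 + Pi.single 2 1 = mkPt z.1 z.2.1 (z.2.2 + 1 : ℕ) := by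
        refine pt_ext_iff.2 ?_
        simp [mkPt]
      simp only [shiftDiff, shift, this]
  · simp only [Nat.add_eq_zero_iff, one_ne_zero, and_false, if_false, Nat.add_sub_cancel]
    have key : ∀ (i : Fin 3) (j : ℤ) (k : ℕ × ℕ × ℕ → ℕ),
        (∀ z, k z ≤ (mkPt z.1 (j - z.2.1) z.2.2 i).natAbs) →
        Rapid k fun z => shiftDiff i K (mkPt z.1 (j - z.2.1) z.2.2, mkPt z.1 (j - z.2.1) z.2.2) := by
      intro i j k hk
      exact ((hK.diff i).comp fun z : ℕ × ℕ × ℕ =>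
        (mkPt z.1 (j - z.2.1) z.2.2, mkPt z.1 (j - z.2.1) z.2.2)).of_weight_le 1 fun z _ => by
          have := hk z
          simp only [Function.comp, dirWeight]; omega
    refine asympPoly_simplexSum ?_ ?_ ?_
    · convert key 0 (-1) (fun z => z.1) (fun z => by simp [mkPt]) using 2 with z
      have : mkPt z.1 (-1 - z.2.1) z.2.2 + Pi.single 0 1
          = mkPt (z.1 + 1 : ℕ) (-1 - z.2.1) z.2.2 := by
        refine pt_ext_iff.2 ?_
        simp [mkPt]
      simp only [shiftDiff, shift, this]
    -- Raising b lowers m = -1 - b, so the difference is minus the increment based at m = -2 - b.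
    · convert (key 1 (-2) (fun z => z.2.1) (fun z => by simp [mkPt]; omega)).neg using 2 with z
      have : mkPt z.1 (-2 - z.2.1) z.2.2 + Pi.single 1 1 = mkPt z.1 (-1 - z.2.1) z.2.2 := by
        refine pt_ext_iff.2 ?_
        simp [mkPt]
        omega
      have h' : mkPt z.1 (-2 - z.2.1) z.2.2 = mkPt z.1 (-1 - (z.2.1 + 1 : ℕ)) z.2.2 := by
        simp [mkPt]; omega
      simp only [Pi.neg_apply, shiftDiff, shift, this]
      rw [h', neg_sub]
    · convert key 2 (-1) (fun z => z.2.2) (fun z => by simp [mkPt]) using 2 with z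
      have : mkPt z.1 (-1 - z.2.1) z.2.2 + Pi.single 2 1
          = mkPt z.1 (-1 - z.2.1) (z.2.2 + 1 : ℕ) := by
        refine pt_ext_iff.2 ?_
        simp [mkPt]
      simp only [shiftDiff, shift, this]

/-! ### Zeta functions -/

/-- Decay faster than every power pushes the abscissa of absolute convergence to -∞. -/
theorem Rapid.differentiable_LSeries {r : ℕ → ℂ} (hr : Rapid id r) :
    Differentiable ℂ (LSeries r) := by
  have h : LSeries.abscissaOfAbsConv r = ⊥ := by
    refine (EReal.eq_bot_iff_forall_lt _).2 fun y => ?_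
    obtain ⟨k, hk⟩ := exists_nat_gt (-y + 1)
    obtain ⟨C, hC0, hC⟩ := hr.exists_bound k
    refine (LSeries.abscissaOfAbsConv_le_of_le_const_mul_rpow (x := -(k : ℝ))
      ⟨C, fun n hn => (hC n).trans ?_⟩).trans_lt ?_
    · have hn' : (0 : ℝ) < n := by exact_mod_cast Nat.pos_of_ne_zero hn
      rw [Real.rpow_neg hn'.le, Real.rpow_natCast]
      refine mul_le_mul_of_nonneg_left (inv_anti₀ (by positivity) ?_) hC0
      simp only [id]
      gcongr
      linarith
    · have : -(k : ℝ) + 1 < y := by linarith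
      exact_mod_cast this
  intro s
  refine (LSeries_differentiableOn r).differentiableAt ?_
  exact (Complex.isOpen_re_gt_EReal _).mem_nhds (h ▸ EReal.bot_lt_coe s.re)

theorem term_one_sub_natCast (s : ℂ) (j : ℕ) {n : ℕ} (hn : n ≠ 0) :
    LSeries.term 1 (s - j) n = (n : ℂ) ^ j * (n : ℂ) ^ (-s) := by
  have hn' : (n : ℂ) ≠ 0 := by exact_mod_cast hn
  rw [LSeries.term_of_ne_zero hn, Complex.cpow_sub _ _ hn', Complex.cpow_natCast, Complex.cpow_neg]
  simp [div_eq_mul_inv]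

/-- If the diagonal sums of `b` over the levels of `|D|` are a quadratic polynomial up to rapid
decay, then `ζ_b` is a combination of shifted zeta functions up to an entire function. -/
theorem exists_entire_zetaFun_eq {b : H →L[ℂ] H} {l₃ l₂ l₁ : ℂ}
    (h : Rapid id fun n => levelSum (opKernel b) n - (l₃ * n ^ 2 + l₂ * n + l₁))
    {ε : ℝ} (hε : 0 < ε) : ∃ ρ : ℂ → ℂ, Differentiable ℂ ρ ∧ ∀ s : ℂ, 3 < s.re →
      zetaFun ε b s = l₃ * riemannZeta (s - 2) + l₂ * riemannZeta (s - 1)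
        + l₁ * riemannZeta s + ρ s := by
  set r : ℕ → ℂ := fun n => levelSum (opKernel b) n - (l₃ * n ^ 2 + l₂ * n + l₁) with hr
  have hε' : (ε : ℂ) ≠ 0 := by exact_mod_cast hε.ne'
  -- An L-series ignores its term at n = 0, so the kernel of D is added by hand; only this summand
  -- involves ε.
  refine ⟨fun s => levelSum (opKernel b) 0 * (ε : ℂ) ^ (-s) + LSeries r s, ?_, fun s hs => ?_⟩
  · refine Differentiable.add (Differentiable.const_mul (fun s => ?_) _) h.differentiable_LSeries
    exact differentiableAt_id.neg.const_cpow (Or.inl hε')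
  have h0 : HasSum (fun n : ℕ => levelSum (opKernel b) n
      * (((if n = 0 then ε else n : ℝ)) : ℂ) ^ (-s)) (zetaFun ε b s) := by
    refine hasSum_levelSum ?_
    have := zetaFun_eq b hε hs
    simpa only [absDiracEig_eq] using this
  have h3 := (LSeriesHasSum_one (s := s - (2 : ℕ)) (by simp; linarith)).mul_left l₃
  have h2 := (LSeriesHasSum_one (s := s - (1 : ℕ)) (by simp; linarith)).mul_left l₂
  have h1 := (LSeriesHasSum_one (s := s - (0 : ℕ)) (by simp; linarith)).mul_left l₁
  have hrs : LSeriesHasSum r s (LSeries r s) := by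
    refine LSeriesSummable.LSeriesHasSum ?_
    refine LSeriesSummable_of_le_const_mul_rpow (x := 1) (by linarith) ?_
    obtain ⟨C, hC⟩ := h.exists_le
    exact ⟨C, fun n _ => by simpa using hC n⟩
  have h5 := ((h3.add h2).add h1).add
    ((hasSum_ite_eq (0 : ℕ) (levelSum (opKernel b) 0 * (ε : ℂ) ^ (-s))).add hrs)
  have e : ∀ n : ℕ, levelSum (opKernel b) n * (((if n = 0 then ε else n : ℝ)) : ℂ) ^ (-s)
      = l₃ * LSeries.term 1 (s - (2 : ℕ)) n + l₂ * LSeries.term 1 (s - (1 : ℕ)) n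
        + l₁ * LSeries.term 1 (s - (0 : ℕ)) n
        + ((if n = 0 then levelSum (opKernel b) 0 * (ε : ℂ) ^ (-s) else 0)
          + LSeries.term r s n) := by
    intro n
    by_cases hn : n = 0
    · subst hn; simp
    · have hn' : (n : ℂ) ≠ 0 := by exact_mod_cast hn
      rw [term_one_sub_natCast s 2 hn, term_one_sub_natCast s 1 hn, term_one_sub_natCast s 0 hn,
        LSeries.term_of_ne_zero hn, if_neg hn, if_neg hn, div_eq_mul_inv, ← Complex.cpow_neg]
      simp only [hr]
      push_cast
      ring
  rw [funext e] at h0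
  rw [h0.unique h5]
  push_cast
  simp

theorem exists_quadratic_levelSum {b : H →L[ℂ] H} (hb : SmoothOp b) : ∃ l₃ l₂ l₁ : ℂ,
    Rapid id fun n => levelSum (opKernel b) n - (l₃ * n ^ 2 + l₂ * n + l₁) :=
  (asympPoly_levelSum hb).exists_quadratic

/-! ### The level sums of the identity -/

theorem simplexSum_one (n : ℕ) : simplexSum (fun _ _ _ => 1) n = (n + 1) * (n + 2) / 2 := by
  have h1 : antiSum (fun _ _ => 1) = fun n : ℕ => (n : ℂ) + 1 := by ext n; simp [antiSum]
  have h0 : ∀ n, antiSum (fun _ _ => 0) n = 0 := fun n => by simp [antiSum]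
  simp only [simplexSum, h1]
  induction n with
  | zero => simp [antiSum]
  | succ n ih =>
    have := antiSum_succ (fun _ m => (m : ℂ) + 1) n
    simp only [sub_self, h0, zero_add] at this
    rw [sub_eq_iff_eq_add, ih] at this
    rw [this]
    push_cast
    ring

/-- This is the multiplicity (n + 1)² of the eigenvalue n of |D|; all three coefficients are
nonzero, so b = 1 witnesses every pole. -/
theorem levelSum_one (n : ℕ) : levelSum (opKernel 1) n = 1 * n ^ 2 + 2 * n + 1 := by
  have h : ∀ (a c : ℕ) (m : ℤ), opKernel 1 (mkPt a m c, mkPt a m c) = 1 := fun a c m => by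
    rw [opKernel_one, if_pos]
    simp [IsLabel, mkPt]
  simp only [levelSum, h, simplexSum_one]
  rcases n with _ | n
  · simp
  · rw [if_neg (Nat.succ_ne_zero n), Nat.add_sub_cancel]
    push_cast
    ring

/-! ### Continuation of the zeta functions -/

open Filter Topology

/-- The entire function `(s - 1) ζ(s)`. -/
def zetaEntire : ℂ → ℂ := Function.update (fun s => (s - 1) * riemannZeta s) 1 1

theorem zetaEntire_of_ne {s : ℂ} (hs : s ≠ 1) : zetaEntire s = (s - 1) * riemannZeta s :=
  Function.update_of_ne hs _ _

theorem zetaEntire_one : zetaEntire 1 = 1 := Function.update_self _ _ _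

/-- At 1 the singularity is removable, the value assigned there being the residue of ζ. -/
theorem differentiable_zetaEntire : Differentiable ℂ zetaEntire := by
  have hd : ∀ z : ℂ, z ≠ 1 → DifferentiableAt ℂ zetaEntire z := fun z hz => by
    have h1 : DifferentiableAt ℂ (fun s => (s - 1) * riemannZeta s) z :=
      (differentiableAt_id.sub_const 1).mul (differentiableAt_riemannZeta hz)
    refine h1.congr_of_eventuallyEq ?_
    filter_upwards [isOpen_ne.mem_nhds hz] with s hs
    exact zetaEntire_of_ne hs
  intro z
  by_cases hz : z = 1
  · subst hz
    refine (Complex.analyticAt_of_differentiable_on_punctured_nhds_of_continuousAt ?_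
      ?_).differentiableAt
    · filter_upwards [self_mem_nhdsWithin] with s hs using hd s hs
    · exact continuousAt_update_same.2 riemannZeta_residue_one
  · exact hd z hz

/-- The meromorphic continuation of `l₃ ζ(s-2) + l₂ ζ(s-1) + l₁ ζ(s) + ρ(s)`. -/
def zetaCont (l₃ l₂ l₁ : ℂ) (ρ : ℂ → ℂ) (s : ℂ) : ℂ :=
  l₃ * zetaEntire (s - 2) / (s - 3) + l₂ * zetaEntire (s - 1) / (s - 2)
    + l₁ * zetaEntire s / (s - 1) + ρ s

theorem zetaCont_eq (l₃ l₂ l₁ : ℂ) (ρ : ℂ → ℂ) {s : ℂ} (hs : s ∉ ({1, 2, 3} : Set ℂ)) :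
    zetaCont l₃ l₂ l₁ ρ s = l₃ * riemannZeta (s - 2) + l₂ * riemannZeta (s - 1)
      + l₁ * riemannZeta s + ρ s := by
  simp only [Set.mem_insert_iff, Set.mem_singleton_iff, not_or] at hs
  obtain ⟨h1, h2, h3⟩ := hs
  have h1' := sub_ne_zero.2 h1
  have h2' := sub_ne_zero.2 h2
  have h3' := sub_ne_zero.2 h3
  rw [zetaCont, zetaEntire_of_ne h1, zetaEntire_of_ne (s := s - 1) (fun h => h2 (by
    linear_combination h)), zetaEntire_of_ne (s := s - 2) (fun h => h3 (by linear_combination h)),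
    show s - 1 - 1 = s - 2 by ring, show s - 2 - 1 = s - 3 by ring]
  field_simp

section Continuation

variable {l₃ l₂ l₁ : ℂ} {ρ : ℂ → ℂ}

theorem analyticAt_zetaEntire_sub (l c z : ℂ) : AnalyticAt ℂ (fun s => l * zetaEntire (s - c)) z :=
  ((differentiable_zetaEntire.comp (differentiable_id.sub_const c)).const_mul l).analyticAt z

theorem neg_one_le_meromorphicOrderAt_div {g : ℂ → ℂ} {z : ℂ} (hg : AnalyticAt ℂ g z) (c : ℂ) :
    MeromorphicAt (fun s => g s / (s - c)) z ∧
      -1 ≤ meromorphicOrderAt (fun s => g s / (s - c)) z := by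
  have hm : MeromorphicAt (fun s => s - c) z :=
    (analyticAt_id.sub analyticAt_const).meromorphicAt
  refine ⟨hg.meromorphicAt.div hm, ?_⟩
  by_cases hz : z = c
  · subst hz
    have e : (fun s => g s / (s - z)) = g * (fun s => s - z)⁻¹ := by
      ext s; simp [div_eq_mul_inv]
    have h1 : meromorphicOrderAt (fun s : ℂ => s - z) z = 1 := by
      exact (meromorphicOrderAt_eq_int_iff hm (n := 1)).2 ⟨fun _ => 1, analyticAt_const, by simp,
        by simp⟩
    rw [e, meromorphicOrderAt_mul hg.meromorphicAt hm.inv, meromorphicOrderAt_inv, h1]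
    have := hg.meromorphicOrderAt_nonneg
    calc (-1 : WithTop ℤ) = 0 + -1 := by simp
      _ ≤ _ := by gcongr
  · have ha : AnalyticAt ℂ (fun s => g s / (s - c)) z :=
      hg.div (analyticAt_id.sub analyticAt_const) (sub_ne_zero.2 hz)
    exact le_trans (by decide) ha.meromorphicOrderAt_nonneg

theorem zetaCont_meromorphicAt (hρ : Differentiable ℂ ρ) (z : ℂ) :
    MeromorphicAt (zetaCont l₃ l₂ l₁ ρ) z ∧
      -1 ≤ meromorphicOrderAt (zetaCont l₃ l₂ l₁ ρ) z := by
  have add : ∀ {f g : ℂ → ℂ}, MeromorphicAt f z ∧ -1 ≤ meromorphicOrderAt f z →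
      MeromorphicAt g z ∧ -1 ≤ meromorphicOrderAt g z →
      MeromorphicAt (f + g) z ∧ -1 ≤ meromorphicOrderAt (f + g) z := fun hf hg =>
    ⟨hf.1.add hg.1, (le_min hf.2 hg.2).trans (meromorphicOrderAt_add hf.1 hg.1)⟩
  have h3 := neg_one_le_meromorphicOrderAt_div (analyticAt_zetaEntire_sub l₃ 2 z) 3
  have h2 := neg_one_le_meromorphicOrderAt_div (analyticAt_zetaEntire_sub l₂ 1 z) 2
  have h1 := neg_one_le_meromorphicOrderAt_div (analyticAt_zetaEntire_sub l₁ 0 z) 1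
  simp only [sub_zero] at h1
  have h0 : MeromorphicAt ρ z ∧ -1 ≤ meromorphicOrderAt ρ z :=
    ⟨(hρ.analyticAt z).meromorphicAt,
      le_trans (by decide) (hρ.analyticAt z).meromorphicOrderAt_nonneg⟩
  exact add (add (add h3 h2) h1) h0

theorem zetaCont_analyticOnNhd (hρ : Differentiable ℂ ρ) :
    AnalyticOnNhd ℂ (zetaCont l₃ l₂ l₁ ρ) ({1, 2, 3} : Set ℂ)ᶜ := by
  intro z hz
  simp only [Set.mem_compl_iff, Set.mem_insert_iff, Set.mem_singleton_iff, not_or] at hz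
  have aux : ∀ c : ℂ, AnalyticAt ℂ (fun s => s - c) z := fun c =>
    analyticAt_id.sub analyticAt_const
  have h1 := (analyticAt_zetaEntire_sub l₁ 0 z).div (aux 1) (sub_ne_zero.2 hz.1)
  simp only [sub_zero] at h1
  exact ((((analyticAt_zetaEntire_sub l₃ 2 z).div (aux 3) (sub_ne_zero.2 hz.2.2)).add
    ((analyticAt_zetaEntire_sub l₂ 1 z).div (aux 2) (sub_ne_zero.2 hz.2.1))).add h1).add
    (hρ.analyticAt z)

theorem tendsto_sub_mul_div {g : ℂ → ℂ} {z : ℂ} (hg : ContinuousAt g z) (c : ℂ) :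
    Tendsto (fun s => (s - z) * (g s / (s - c))) (𝓝[≠] z) (𝓝 (if z = c then g z else 0)) := by
  split_ifs with h
  · subst h
    refine (hg.tendsto.mono_left nhdsWithin_le_nhds).congr' ?_
    filter_upwards [self_mem_nhdsWithin] with s hs
    have : s - z ≠ 0 := sub_ne_zero.2 hs
    field_simp
  · have h1 : ContinuousAt (fun s => (s - z) * (g s / (s - c))) z :=
      (continuousAt_id.sub continuousAt_const).mul
        (hg.div (continuousAt_id.sub continuousAt_const) (sub_ne_zero.2 h))
    have := h1.tendsto
    simp only [sub_self, zero_mul] at this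
    exact this.mono_left nhdsWithin_le_nhds

/-- The residues at 3, 2 and 1 are l₃, l₂ and l₁, because `zetaEntire` takes the value 1 at 1. -/
theorem tendsto_residue_zetaCont (hρ : Differentiable ℂ ρ) (z : ℂ) :
    Tendsto (fun s => (s - z) * zetaCont l₃ l₂ l₁ ρ s) (𝓝[≠] z)
      (𝓝 ((if z = 3 then l₃ else 0) + (if z = 2 then l₂ else 0) + if z = 1 then l₁ else 0)) := by
  have h3 := tendsto_sub_mul_div (analyticAt_zetaEntire_sub l₃ 2 z).continuousAt 3
  have h2 := tendsto_sub_mul_div (analyticAt_zetaEntire_sub l₂ 1 z).continuousAt 2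
  have h1 := tendsto_sub_mul_div (analyticAt_zetaEntire_sub l₁ 0 z).continuousAt 1
  have h0 : Tendsto (fun s => (s - z) * ρ s) (𝓝[≠] z) (𝓝 0) := by
    have h : ContinuousAt (fun s => (s - z) * ρ s) z :=
      (continuousAt_id.sub continuousAt_const).mul hρ.continuous.continuousAt
    have := h.tendsto
    simp only [sub_self, zero_mul] at this
    exact this.mono_left nhdsWithin_le_nhds
  have h := ((h3.add h2).add h1).add h0
  convert h using 2 with s
  · simp only [zetaCont, sub_zero]; ring
  · have e : ∀ (l w c d : ℂ), w = d → d - c = 1 → l * zetaEntire (w - c) = l := by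
      rintro l w c d rfl h
      rw [h, zetaEntire_one, mul_one]
    rw [add_zero]
    congr 1
    · congr 1
      · exact ite_congr rfl (fun h => (e _ _ _ _ h (by norm_num)).symm) fun _ => rfl
      · exact ite_congr rfl (fun h => (e _ _ _ _ h (by norm_num)).symm) fun _ => rfl
    · exact ite_congr rfl (fun h => (e _ _ _ _ h (by norm_num)).symm) fun _ => rfl

end Continuation

/-! ### The dimension spectrum -/

theorem finite_poles : ({1, 2, 3} : Set ℂ).Finite := by simp

theorem isSimpleDimensionSpectrum {ε : ℝ} (hε : 0 < ε) :
    IsSimpleDimensionSpectrum 3 {ζ | ∃ b ∈ algB, ζ = zetaFun ε b} {1, 2, 3} where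
  isClosed := finite_poles.isClosed
  isDiscrete := finite_poles.isDiscrete
  extension := by
    rintro _ ⟨b, hb, rfl⟩
    obtain ⟨l₃, l₂, l₁, hl⟩ := exists_quadratic_levelSum (smoothOp_of_mem_algB hb)
    obtain ⟨ρ, hρ, h⟩ := exists_entire_zetaFun_eq hl hε
    exact ⟨zetaCont l₃ l₂ l₁ ρ, fun z => (zetaCont_meromorphicAt hρ z).1,
      zetaCont_analyticOnNhd hρ, fun z _ => (zetaCont_meromorphicAt hρ z).2,
      fun s hs hs' => by rw [h s hs, zetaCont_eq _ _ _ _ hs']⟩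
  singular := by
    intro z hz
    refine ⟨_, ⟨1, one_mem _, rfl⟩, ?_⟩
    rintro ⟨Z, hZ, hZeq⟩
    obtain ⟨ρ, hρ, h⟩ := exists_entire_zetaFun_eq (b := 1) (l₃ := 1) (l₂ := 2) (l₁ := 1)
      (by simp only [levelSum_one, sub_self]; exact Rapid.zero _) hε
    -- The plane minus three points is connected, so by the identity theorem Z agrees there with the
    -- explicit continuation. An extension holomorphic at z would have residue 0, against 1, 2 or 1.
    have hpre : IsPreconnected ({1, 2, 3} : Set ℂ)ᶜ :=
      (finite_poles.countable.isPathConnected_compl_of_one_lt_rank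
        (by rw [Complex.rank_real_complex]; norm_num)).isConnected.isPreconnected
    have h4 : (4 : ℂ) ∈ ({1, 2, 3} : Set ℂ)ᶜ := by norm_num
    have heq : Set.EqOn Z (zetaCont 1 2 1 ρ) ({1, 2, 3} : Set ℂ)ᶜ := by
      refine AnalyticOnNhd.eqOn_of_preconnected_of_eventuallyEq
        (hZ.mono (Set.subset_insert _ _)) (zetaCont_analyticOnNhd hρ) hpre h4 ?_
      have ho : IsOpen {s : ℂ | 3 < s.re} := isOpen_lt continuous_const Complex.continuous_re
      filter_upwards [ho.mem_nhds (show (3 : ℝ) < (4 : ℂ).re by norm_num),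
        finite_poles.isClosed.isOpen_compl.mem_nhds h4] with s hs hs'
      rw [hZeq s hs hs', h s hs, zetaCont_eq _ _ _ _ hs']
    have hev : ∀ᶠ s in 𝓝[≠] z, s ∈ ({1, 2, 3} : Set ℂ)ᶜ := by
      have hc : IsClosed (({1, 2, 3} : Set ℂ) \ {z}) := (finite_poles.sdiff).isClosed
      have h1 : (({1, 2, 3} : Set ℂ) \ {z})ᶜ ∈ 𝓝 z := hc.isOpen_compl.mem_nhds (by simp)
      filter_upwards [nhdsWithin_le_nhds h1, self_mem_nhdsWithin] with s hs hs' hs3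
      exact hs ⟨hs3, hs'⟩
    have hlim0 : Tendsto (fun s => (s - z) * Z s) (𝓝[≠] z) (𝓝 0) := by
      have h1 : ContinuousAt (fun s => (s - z) * Z s) z :=
        (continuousAt_id.sub continuousAt_const).mul
          (hZ z (Set.mem_insert _ _)).continuousAt
      have := h1.tendsto
      simp only [sub_self, zero_mul] at this
      exact this.mono_left nhdsWithin_le_nhds
    have hlim := (tendsto_residue_zetaCont (l₃ := 1) (l₂ := 2) (l₁ := 1) hρ z).congr' (by
      filter_upwards [hev] with s hs
      rw [← heq hs])
    have := tendsto_nhds_unique hlim hlim0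
    rcases hz with rfl | rfl | rfl <;> norm_num at this

end QuantumSU2

end

open QuantumSU2
theorem theorem2 :
    -- the elements `a`, `[D, a]`, for `a ∈ 𝒜`, are in the domain of all the powers of `δ`
    (∀ a ∈ smoothAlg, ∃ da, IsCommutator dirac a da ∧
      ∀ k : ℕ, (∃ T, IsDelta k a T) ∧ ∃ T, IsDelta k da T) ∧
    -- `b |D|^{-s}` is of trace class for `b ∈ ℬ` and `Re s > 3`
    (∀ ε : ℝ, 0 < ε → ∀ b ∈ algB, ∀ s : ℂ, 3 < s.re →
      IsTraceClass (b * absDiracNegPow ε s)) ∧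
    -- the dimension spectrum is simple and equal to `{1, 2, 3}`
    (∀ ε : ℝ, 0 < ε → IsSimpleDimensionSpectrum 3 {ζ | ∃ b ∈ algB, ζ = zetaFun ε b} {1, 2, 3}) ∧
    -- the form of the zeta functions
    (∀ b ∈ algB, ∃ l₃ l₂ l₁ : ℂ, ∀ ε : ℝ, 0 < ε → ∃ ρ : ℂ → ℂ, Differentiable ℂ ρ ∧
      ∀ s : ℂ, 3 < s.re →
        zetaFun ε b s = l₃ * riemannZeta (s - 2) + l₂ * riemannZeta (s - 1)
          + l₁ * riemannZeta s + ρ s) := by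
  refine ⟨fun a ha => ?_, fun ε hε b _ s hs => isTraceClass_mul_absDiracNegPow b hε hs,
    fun ε hε => isSimpleDimensionSpectrum hε, fun b hb => ?_⟩
  · obtain ⟨da, hda⟩ := exists_isCommutator_dirac ha
    exact ⟨da, hda, fun k => ⟨(smoothOp_of_mem_smoothAlg ha).exists_isDelta k,
      (smoothOp_of_isCommutator_dirac ha hda).exists_isDelta k⟩⟩
  · obtain ⟨l₃, l₂, l₁, hl⟩ := exists_quadratic_levelSum (smoothOp_of_mem_algB hb)
    exact ⟨l₃, l₂, l₁, fun ε hε => exists_entire_zetaFun_eq hl hε⟩
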